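/- **Setting.** A principal offers a contract to an agent, who chooses an effort $\eta\in[0,1]$. The principal inspects $n$ samples. Given $\eta$, they pass independently, each with probability $(1+c\eta)/2$, where $c\in(0,1]$ is fixed; let $A\in\{0,1\}^n$ record which samples pass. A contract is a function $F:\{0,1\}^n\to[\underline w,\overline w]$, and the agent is paid $F(A)$. It is *binary* if $F=w+w_b\Psi$ for some test $\Psi:\{0,1\}^n\to\{0,1\}$, base salary $w\in\mathbb R$ and bonus $w_b\ge 0$; let $\mathcal F_n^{\mathrm{bin}}$ be the set of binary contracts. Under wage $w_a$ and effort $\eta$ the agent has utility $U_a(w_a,\eta)=G_a(w_a)-E(\eta)$ and the principal has utility $U_p(w_a,\eta)=-w_a+\mu(\eta)$. Write $\mathbb E_\eta$ for the expectation over $A$ under effort $\eta$. **Assumptions.** 1. $G_a:\mathbb R\to\mathbb R$ is $C^2$ with $G_a'>0$ and $G_a''<0$; $E:[0,1]\to\mathbb R$ is $C^2$ with $E'>0$ and $E''\ge 0$ on $(0,1)$. 2. $\mu:[0,1]\to\mathbb R$ is $C^2$ with $\mu'\ge 0$ and $\mu''\le 0$ on $(0,1)$. 3. For the wage bounds $\underline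 w,\overline w\in\mathbb R$ and the leisure utility $U_0\in\mathbb R$, $\;E([0,1])+U_0\subset \operatorname{int} G_a([\underline w,\overline w])$. 4. The maximizer $\eta^*$ of $-G_a^{-1}(E(\eta)+U_0)+\mu(\eta)$ over $\eta\in[0,1]$ lies in $(0,1)$. **Values.** Let $\mathcal F_n$ be any class of contracts with values in $[\underline w,\overline w]$ that contains $\mathcal F_n^{\mathrm{bin}}$. The first-best value is $$\mathcal C=\max\{\mathbb E_\eta U_p(F(A),\eta): F\in\mathcal F_n,\ \eta\in[0,1],\ \mathbb E_\eta U_a(F(A),\eta)\ge U_0\}.$$ The second-best value for binary contracts is $$\mathcal C_n^{\mathrm{bin}}=\max\{\mathbb E_\eta U_p(F(A),\eta): F\in\mathcal F_n^{\mathrm{bin}},\ \mathbb E_\eta U_a(F(A),\eta)\ge U_0,\ \eta\in\operatorname{argmax}_{\eta'\in[0,1]}\mathbb E_{\eta'}U_a(F(A),\eta')\}.$$ The restricted second-best value $\tilde{\mathcal C}_n^{\mathrm{bin}}$ is the same maximum with $\eta$ fixed to be $\eta^*$. **Theorem.** Under these assumptions the maxima defining $\mathcal C$ and $\mathcal C_n^{\mathrm{bin}}$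 are attained for every $n$, the maximum defining $\tilde{\mathcal C}_n^{\mathrm{bin}}$ is over a non-empty set and attained for all sufficiently large $n$, and, as $n\to\infty$ with $c,G_a,E,\mu,U_0,\underline w,\overline w$ fixed, $$\mathcal C-\tilde{\mathcal C}_n^{\mathrm{bin}}=\Theta\!\left(\frac1{\sqrt{n\log n}}\right),\qquad \mathcal C-\mathcal C_n^{\mathrm{bin}}=\Theta\!\left(\frac1{\sqrt{n\log n}}\right).$$ -/

import Mathlib

open Set Filter Topology Asymptotics

noncomputable section

/-- Data of the principal-agent model: the monetary utility `G` of the agent, the cost of effort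
`E`, the principal's utility `μ` of the effort, the leisure utility `U₀`, the lower and upper wage
bounds, and the informativeness `c` of one inspected sample. The functions `E` and `μ` matter only
on `[0, 1]`. -/
structure PAModel where
  G : ℝ → ℝ
  E : ℝ → ℝ
  μ : ℝ → ℝ
  U₀ : ℝ
  wLow : ℝ
  wHigh : ℝ
  c : ℝ

/-- The assessment data of `n` inspected samples: which of them pass. -/
abbrev Outcome (n : ℕ) : Type := Fin n → Bool

/-- A contract on `n` samples: the payment to the agent as a function of the data. -/
abbrev Contract (n : ℕ) : Type := Outcome n → ℝ

namespace PAModel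

variable (M : PAModel)

/-- The probability that a sample passes when the effort is `η`. -/
def passProb (η : ℝ) : ℝ := (1 + M.c * η) / 2

/-- The probability of the data `a` under effort `η`: independent samples, each of which passes
with probability `M.passProb η`. -/
def outcomeProb {n : ℕ} (η : ℝ) (a : Outcome n) : ℝ :=
  ∏ i, if a i then M.passProb η else 1 - M.passProb η

/-- The expectation of `X` under effort `η`. -/
def expect {n : ℕ} (η : ℝ) (X : Outcome n → ℝ) : ℝ :=
  ∑ a, M.outcomeProb η a * X a

/-- The agent's utility of wage `w` and effort `η`. -/
def agentUtility (w η : ℝ) : ℝ := M.G w - M.E η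

/-- The principal's utility of wage `w` and effort `η`. -/
def principalUtility (w η : ℝ) : ℝ := -w + M.μ η

/-- The agent's expected utility under the contract `F` and effort `η`. -/
def agentValue {n : ℕ} (F : Contract n) (η : ℝ) : ℝ :=
  M.expect η fun a => M.agentUtility (F a) η

/-- The principal's expected utility under the contract `F` and effort `η`. -/
def principalValue {n : ℕ} (F : Contract n) (η : ℝ) : ℝ :=
  M.expect η fun a => M.principalUtility (F a) η

/-- Individual rationality. -/
def IsIR {n : ℕ} (F : Contract n) (η : ℝ) : Prop := M.U₀ ≤ M.agentValue F η

/-- Incentive compatibility: the effort `η` is a best response of the agent to `F`. -/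
def IsIC {n : ℕ} (F : Contract n) (η : ℝ) : Prop :=
  η ∈ Icc (0 : ℝ) 1 ∧ ∀ η' ∈ Icc (0 : ℝ) 1, M.agentValue F η' ≤ M.agentValue F η

/-- The contracts that respect the wage bounds. -/
def boundedContracts (n : ℕ) : Set (Contract n) :=
  {F | ∀ a, F a ∈ Icc M.wLow M.wHigh}

/-- The binary contracts that respect the wage bounds: a base salary `w`, and a bonus `b` that is
paid when the data pass the test `Ψ`. -/
def binaryContracts (n : ℕ) : Set (Contract n) :=
  {F | F ∈ M.boundedContracts n ∧ ∃ (Ψ : Outcome n → Bool) (w b : ℝ), 0 ≤ b ∧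
    ∀ a, F a = if Ψ a then w + b else w}

/-- The objective values of the first-best program over the contract class `𝓕`. -/
def firstBestValues {n : ℕ} (𝓕 : Set (Contract n)) : Set ℝ :=
  {v | ∃ F ∈ 𝓕, ∃ η ∈ Icc (0 : ℝ) 1, M.IsIR F η ∧ v = M.principalValue F η}

/-- The objective values of the second-best program over the contract class `𝓕`. -/
def secondBestValues {n : ℕ} (𝓕 : Set (Contract n)) : Set ℝ :=
  {v | ∃ F ∈ 𝓕, ∃ η, M.IsIR F η ∧ M.IsIC F η ∧ v = M.principalValue F η}

/-- The objective values of the restricted second-best program over the contract class `𝓕`, in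
which the agent has to choose the effort `ηstar`. -/
def restrictedValues (ηstar : ℝ) {n : ℕ} (𝓕 : Set (Contract n)) : Set ℝ :=
  {v | ∃ F ∈ 𝓕, M.IsIR F ηstar ∧ M.IsIC F ηstar ∧ v = M.principalValue F ηstar}

/-- The first-best value. -/
def firstBest {n : ℕ} (𝓕 : Set (Contract n)) : ℝ := sSup (M.firstBestValues 𝓕)

/-- The second-best value. -/
def secondBest {n : ℕ} (𝓕 : Set (Contract n)) : ℝ := sSup (M.secondBestValues 𝓕)

/-- The restricted second-best value. -/
def restrictedSecondBest (ηstar : ℝ) {n : ℕ} (𝓕 : Set (Contract n)) : ℝ :=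
  sSup (M.restrictedValues ηstar 𝓕)

/-- `ηstar` is a first-best effort: it maximizes `μ η - G⁻¹ (E η + U₀)` over `[0, 1]`. -/
def IsFirstBestEffort (ηstar : ℝ) : Prop :=
  ηstar ∈ Icc (0 : ℝ) 1 ∧
    IsMaxOn (fun η => -Function.invFun M.G (M.E η + M.U₀) + M.μ η) (Icc 0 1) ηstar

end PAModel

end

/-! A constant wage attains `effortValue ηstar`, and by Jensen's inequality no individually rational
contract does better, so this is the first-best value. A binary contract has to put the agent at
risk. With utility spread Δ = G w₂ - G w₁ and passing probability P, strong concavity of `G` on the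
wage range makes the risk premium at least of order P (1 - P) Δ² (`exists_risk_premium`). Everything
depends on how small P (1 - P) can be made by an incentive-compatible contract.

Lower bound on the gaps. By strict concavity of `effortValue`, efforts outside a compact interval
around `ηstar` lose a constant. Inside it, the first-order condition Δ P' = E' with bounded Δ bounds
P' below, and P' is the mean of the score over the event that the test passes. The score is a sum of
n independent, centred, bounded terms, so it exceeds √(n log n) in order of magnitude only with
negligible probability. Hence P, and by symmetry 1 - P, is at least of order 1 / √(n log n)
(`exists_passTest_lower`). Deviating to zero effort shows that Δ cannot be small either.

Upper bound on the gaps. The contract pays a bonus when more than j samples pass, with j below the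
mean at `ηstar`. The slope of the passing probability is (n + 1) times a binomial probability at j,
up to the factor c / 2. Keeping it of constant order forces j to lie about √(n log n) or more below
the mean (`exists_threshold`), and there a geometric series bounds the failure probability by order
1 / √(n log n) (`sum_binomProb_lower_le`). The loss is at most proportional to it. The passing
probability is sigmoid in the effort, which upgrades the first-order condition to global incentive
compatibility (`isMaxOn_of_sigmoid`). -/

noncomputable section

namespace PAModel

/-- The standing assumptions of the model, apart from the one on the first-best effort. -/
structure Regular (M : PAModel) : Prop where
  c_pos : 0 < M.c
  c_le : M.c ≤ 1
  contDiff_G : ContDiff ℝ 2 M.G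
  deriv_G_pos : ∀ w, 0 < deriv M.G w
  deriv2_G_neg : ∀ w, deriv (deriv M.G) w < 0
  contDiffOn_E : ContDiffOn ℝ 2 M.E (Icc 0 1)
  deriv_E_pos : ∀ η ∈ Ioo (0 : ℝ) 1, 0 < deriv M.E η
  deriv2_E_nonneg : ∀ η ∈ Ioo (0 : ℝ) 1, 0 ≤ deriv (deriv M.E) η
  contDiffOn_μ : ContDiffOn ℝ 2 M.μ (Icc 0 1)
  deriv2_μ_nonpos : ∀ η ∈ Ioo (0 : ℝ) 1, deriv (deriv M.μ) η ≤ 0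
  wage_range : (fun η => M.E η + M.U₀) '' Icc 0 1 ⊆ interior (M.G '' Icc M.wLow M.wHigh)

/-- The wage that compensates the agent exactly for the effort `η`. -/
def reservationWage (M : PAModel) (η : ℝ) : ℝ := Function.invFun M.G (M.E η + M.U₀)

/-- The principal's value of the effort `η` when it is contractible. -/
def effortValue (M : PAModel) (η : ℝ) : ℝ := -M.reservationWage η + M.μ η

/-- The probability that the test `Ψ` is passed under effort `η`. -/
def passTest (M : PAModel) {n : ℕ} (Ψ : Outcome n → Bool) (η : ℝ) : ℝ :=
  M.expect η fun a => if Ψ a then 1 else 0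

lemma differentiableOn_deriv_of_contDiffOn {f : ℝ → ℝ} (hf : ContDiffOn ℝ 2 f (Icc 0 1)) :
    DifferentiableOn ℝ f (Ioo 0 1) ∧ DifferentiableOn ℝ (deriv f) (Ioo 0 1) := by
  have h : ContDiffOn ℝ 2 f (Ioo 0 1) := hf.mono Ioo_subset_Icc_self
  refine ⟨h.differentiableOn (by norm_num), ?_⟩
  exact (h.deriv_of_isOpen isOpen_Ioo (m := 1) (by norm_num)).differentiableOn (by norm_num)

/-! ### Expectations, tests and binary contracts -/

section Expectation

variable (M : PAModel) {n : ℕ}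

lemma outcomeProb_nonneg {η : ℝ} (h₀ : 0 ≤ M.passProb η) (h₁ : M.passProb η ≤ 1)
    (a : Outcome n) : 0 ≤ M.outcomeProb η a := by
  refine Finset.prod_nonneg fun i _ => ?_
  split_ifs <;> linarith

lemma sum_prod_outcome (f : Bool → ℝ) :
    ∑ a : Outcome n, ∏ i, f (a i) = (f true + f false) ^ n := by
  rw [← Fintype.sum_pow]
  simp

lemma sum_outcomeProb (η : ℝ) : ∑ a : Outcome n, M.outcomeProb η a = 1 := by
  have := sum_prod_outcome (n := n)
    (fun b => if b then M.passProb η else 1 - M.passProb η)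
  simpa [outcomeProb] using this

lemma expect_add (η : ℝ) (X Y : Outcome n → ℝ) :
    M.expect η (fun a => X a + Y a) = M.expect η X + M.expect η Y := by
  simp [expect, mul_add, Finset.sum_add_distrib]

lemma expect_const_mul (η r : ℝ) (X : Outcome n → ℝ) :
    M.expect η (fun a => r * X a) = r * M.expect η X := by
  simp only [expect, Finset.mul_sum]
  exact Finset.sum_congr rfl fun a _ => by ring

lemma expect_const (η r : ℝ) : M.expect η (fun _ : Outcome n => r) = r := by
  simp [expect, ← Finset.sum_mul, sum_outcomeProb]

lemma expect_mono {η : ℝ} (h₀ : 0 ≤ M.passProb η) (h₁ : M.passProb η ≤ 1)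
    {X Y : Outcome n → ℝ} (h : ∀ a, X a ≤ Y a) : M.expect η X ≤ M.expect η Y :=
  Finset.sum_le_sum fun a _ =>
    mul_le_mul_of_nonneg_left (h a) (M.outcomeProb_nonneg h₀ h₁ a)

lemma passTest_nonneg {η : ℝ} (h₀ : 0 ≤ M.passProb η) (h₁ : M.passProb η ≤ 1)
    (Ψ : Outcome n → Bool) : 0 ≤ M.passTest Ψ η := by
  have := M.expect_mono h₀ h₁ (X := fun _ => 0) (Y := fun a => if Ψ a then 1 else 0)
    fun a => by split_ifs <;> norm_num
  rwa [expect_const] at this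

lemma passTest_not (Ψ : Outcome n → Bool) (η : ℝ) :
    M.passTest (fun a => !Ψ a) η = 1 - M.passTest Ψ η := by
  have h := M.expect_add η (fun a => if Ψ a then 1 else 0) (fun a => if !Ψ a then 1 else 0)
  have h' : (fun a : Outcome n => ((if Ψ a then 1 else 0) + if !Ψ a then 1 else 0 : ℝ))
      = fun _ => 1 := by
    funext a; cases Ψ a <;> simp
  rw [h', expect_const] at h
  unfold passTest
  linarith

lemma expect_ite (Ψ : Outcome n → Bool) (x y η : ℝ) :
    M.expect η (fun a => if Ψ a then y else x) = x + (y - x) * M.passTest Ψ η := by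
  have h : (fun a : Outcome n => if Ψ a then y else x)
      = fun a => x + (y - x) * (if Ψ a then 1 else 0) := by
    funext a; split_ifs <;> ring
  rw [h, expect_add, expect_const, expect_const_mul, passTest]

lemma agentValue_eq (F : Contract n) (η : ℝ) :
    M.agentValue F η = M.expect η (fun a => M.G (F a)) - M.E η := by
  have := M.expect_add η (fun a => M.G (F a)) (fun _ => - M.E η)
  rw [expect_const] at this
  simpa only [agentValue, agentUtility, sub_eq_add_neg] using this

lemma principalValue_eq (F : Contract n) (η : ℝ) :
    M.principalValue F η = -M.expect η F + M.μ η := by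
  have := M.expect_add η (fun a => (-1) * F a) (fun _ => M.μ η)
  rw [expect_const, expect_const_mul] at this
  simpa [principalValue, principalUtility] using this

lemma agentValue_ite (Ψ : Outcome n → Bool) (w₁ w₂ η : ℝ) :
    M.agentValue (fun a => if Ψ a then w₂ else w₁) η
      = M.G w₁ + (M.G w₂ - M.G w₁) * M.passTest Ψ η - M.E η := by
  rw [agentValue_eq, ← expect_ite]
  congr 2
  funext a
  split_ifs <;> rfl

lemma principalValue_ite (Ψ : Outcome n → Bool) (w₁ w₂ η : ℝ) :
    M.principalValue (fun a => if Ψ a then w₂ else w₁) η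
      = -(w₁ + (w₂ - w₁) * M.passTest Ψ η) + M.μ η := by
  rw [principalValue_eq, ← expect_ite]

/-- A binary contract has two wages within the bounds, ordered by the test. -/
lemma mem_binaryContracts_iff {F : Contract n} :
    F ∈ M.binaryContracts n ↔ ∃ (Ψ : Outcome n → Bool) (w₁ w₂ : ℝ),
      w₁ ∈ Icc M.wLow M.wHigh ∧ w₂ ∈ Icc M.wLow M.wHigh ∧ w₁ ≤ w₂ ∧
        F = fun a => if Ψ a then w₂ else w₁ := by
  constructor
  · rintro ⟨hF, Ψ, w, b, hb, h⟩
    have hb' : ∀ a, (if Ψ a then w + b else w) ∈ Icc M.wLow M.wHigh := fun a => h a ▸ hF a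
    -- A wage that is never paid may violate the bounds. If the test is constant on the data, the
    -- contract is rewritten with both wages equal to the one that is paid.
    by_cases h1 : ∃ a, Ψ a = true
    · obtain ⟨a, ha⟩ := h1
      have hwb : w + b ∈ Icc M.wLow M.wHigh := by simpa [ha] using hb' a
      by_cases h2 : ∃ a, Ψ a = false
      · obtain ⟨a', ha'⟩ := h2
        have hw : w ∈ Icc M.wLow M.wHigh := by simpa [ha'] using hb' a'
        exact ⟨Ψ, w, w + b, hw, hwb, by linarith, funext h⟩
      · push Not at h2
        exact ⟨Ψ, w + b, w + b, hwb, hwb, le_rfl, by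
          funext a; rw [h a, if_pos (by simpa using h2 a)]; simp⟩
    · push Not at h1
      have hw : w ∈ Icc M.wLow M.wHigh := by
        simpa [h1] using hb' fun _ => true
      exact ⟨Ψ, w, w, hw, hw, le_rfl, by funext a; rw [h a, if_neg (h1 a)]; simp⟩
  · rintro ⟨Ψ, w₁, w₂, h₁, h₂, h, rfl⟩
    refine ⟨fun a => ?_, Ψ, w₁, w₂ - w₁, by linarith, fun a => by
      simp⟩
    dsimp only
    split_ifs <;> assumption

end Expectation

/-! ### Regularity of the model and the first-best value -/

namespace Regular

variable {M : PAModel}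

lemma continuous_G (h : M.Regular) : Continuous M.G := h.contDiff_G.continuous

lemma differentiable_G (h : M.Regular) : Differentiable ℝ M.G :=
  h.contDiff_G.differentiable (by norm_num)

lemma strictMono_G (h : M.Regular) : StrictMono M.G := strictMono_of_deriv_pos h.deriv_G_pos

lemma contDiff_deriv_G (h : M.Regular) : ContDiff ℝ 1 (deriv M.G) := by
  have := (contDiff_succ_iff_deriv (n := 1) (f := M.G) (𝕜 := ℝ)).1
    (by simpa using (show ContDiff ℝ (1 + 1) M.G from by
      rw [one_add_one_eq_two]; exact h.contDiff_G))
  exact this.2.2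

lemma concaveOn_G (h : M.Regular) : StrictConcaveOn ℝ univ M.G :=
  strictConcaveOn_of_deriv2_neg convex_univ h.continuous_G.continuousOn
    fun x _ => h.deriv2_G_neg x

lemma passProb_mem (h : M.Regular) {η : ℝ} (hη : η ∈ Icc (0 : ℝ) 1) :
    M.passProb η ∈ Icc (1 / 2 : ℝ) 1 := by
  have := h.c_pos; have := h.c_le; obtain ⟨h0, h1⟩ := hη
  unfold passProb
  constructor
  · nlinarith
  · nlinarith [mul_le_one₀ h.c_le h0 h1]

lemma passProb_nonneg (h : M.Regular) {η : ℝ} (hη : η ∈ Icc (0 : ℝ) 1) : 0 ≤ M.passProb η := by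
  have := (h.passProb_mem hη).1; linarith

lemma passProb_le_one (h : M.Regular) {η : ℝ} (hη : η ∈ Icc (0 : ℝ) 1) : M.passProb η ≤ 1 :=
  (h.passProb_mem hη).2

lemma continuousOn_E (h : M.Regular) : ContinuousOn M.E (Icc 0 1) := h.contDiffOn_E.continuousOn

lemma convexOn_E (h : M.Regular) : ConvexOn ℝ (Icc 0 1) M.E := by
  obtain ⟨h1, h2⟩ := differentiableOn_deriv_of_contDiffOn h.contDiffOn_E
  refine convexOn_of_deriv2_nonneg (convex_Icc _ _) h.continuousOn_E ?_ ?_ ?_ <;>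
    rw [interior_Icc]
  exacts [h1, h2, h.deriv2_E_nonneg]

lemma concaveOn_μ (h : M.Regular) : ConcaveOn ℝ (Icc 0 1) M.μ := by
  obtain ⟨h1, h2⟩ := differentiableOn_deriv_of_contDiffOn h.contDiffOn_μ
  refine concaveOn_of_deriv2_nonpos (convex_Icc _ _) h.contDiffOn_μ.continuousOn ?_ ?_ ?_ <;>
    rw [interior_Icc]
  exacts [h1, h2, h.deriv2_μ_nonpos]

lemma strictMonoOn_E (h : M.Regular) : StrictMonoOn M.E (Icc 0 1) := by
  refine strictMonoOn_of_deriv_pos (convex_Icc _ _) h.continuousOn_E ?_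
  rw [interior_Icc]
  exact h.deriv_E_pos

lemma hasDerivAt_E (h : M.Regular) {η : ℝ} (hη : η ∈ Ioo (0 : ℝ) 1) :
    HasDerivAt M.E (deriv M.E η) η :=
  ((differentiableOn_deriv_of_contDiffOn h.contDiffOn_E).1.differentiableAt
    (isOpen_Ioo.mem_nhds hη)).hasDerivAt

lemma monotoneOn_deriv_E (h : M.Regular) : MonotoneOn (deriv M.E) (Ioo 0 1) := by
  obtain ⟨-, h2⟩ := differentiableOn_deriv_of_contDiffOn h.contDiffOn_E
  refine monotoneOn_of_deriv_nonneg (convex_Ioo _ _) h2.continuousOn ?_ ?_ <;> rw [interior_Ioo]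
  exacts [h2, h.deriv2_E_nonneg]

lemma utility_mem (h : M.Regular) {η : ℝ} (hη : η ∈ Icc (0 : ℝ) 1) :
    M.E η + M.U₀ ∈ Ioo (M.G M.wLow) (M.G M.wHigh) := by
  have h1 : M.G '' Icc M.wLow M.wHigh ⊆ Icc (M.G M.wLow) (M.G M.wHigh) := by
    rintro _ ⟨w, hw, rfl⟩
    exact ⟨h.strictMono_G.monotone hw.1, h.strictMono_G.monotone hw.2⟩
  have h2 := interior_mono h1 (h.wage_range ⟨η, hη, rfl⟩)
  rwa [interior_Icc] at h2

lemma wLow_lt_wHigh (h : M.Regular) : M.wLow < M.wHigh := by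
  obtain ⟨h1, h2⟩ := h.utility_mem (η := 0) (by simp)
  exact h.strictMono_G.lt_iff_lt.1 (h1.trans h2)

lemma exists_wage (h : M.Regular) {y : ℝ} (hy : y ∈ Icc (M.G M.wLow) (M.G M.wHigh)) :
    ∃ w ∈ Icc M.wLow M.wHigh, M.G w = y :=
  intermediate_value_Icc h.wLow_lt_wHigh.le h.continuous_G.continuousOn hy

lemma reservationWage_spec (h : M.Regular) {η : ℝ} (hη : η ∈ Icc (0 : ℝ) 1) :
    M.reservationWage η ∈ Icc M.wLow M.wHigh ∧ M.G (M.reservationWage η) = M.E η + M.U₀ := by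
  obtain ⟨w, hw, hw'⟩ := h.exists_wage (Ioo_subset_Icc_self (h.utility_mem hη))
  have : M.reservationWage η = w := by
    rw [reservationWage, ← hw', Function.leftInverse_invFun h.strictMono_G.injective w]
  rw [this]
  exact ⟨hw, hw'⟩

/-- The reservation wage is the inverse of a strictly concave increasing function, composed with a
convex one. Strictness survives even where `E` is affine, because `E` is injective and so distinct
efforts have distinct wages. -/
lemma strictConcaveOn_effortValue (h : M.Regular) :
    StrictConcaveOn ℝ (Icc 0 1) M.effortValue := by
  have hw : StrictConvexOn ℝ (Icc 0 1) M.reservationWage := by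
    refine ⟨convex_Icc _ _, fun x hx y hy hxy a b ha hb hab => ?_⟩
    have hz : a • x + b • y ∈ Icc (0 : ℝ) 1 := convex_Icc _ _ hx hy ha.le hb.le hab
    have hx' := (h.reservationWage_spec hx).2
    have hy' := (h.reservationWage_spec hy).2
    have hz' := (h.reservationWage_spec hz).2
    have hne : M.reservationWage x ≠ M.reservationWage y := by
      intro he
      rw [he, hy'] at hx'
      exact hxy (h.strictMonoOn_E.injOn hx hy (by linarith))
    have h1 := h.concaveOn_G.2 (mem_univ _) (mem_univ _) hne ha hb hab
    have h2 := h.convexOn_E.2 hx hy ha.le hb.le hab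
    refine h.strictMono_G.lt_iff_lt.1 (lt_of_le_of_lt ?_ h1)
    rw [hx', hy', hz']
    simp only [smul_eq_mul] at h2 ⊢
    linear_combination h2 - M.U₀ * hab
  exact hw.neg.add_concaveOn h.concaveOn_μ

lemma effortValue_le {ηstar : ℝ} (hs : M.IsFirstBestEffort ηstar) {η : ℝ}
    (hη : η ∈ Icc (0 : ℝ) 1) : M.effortValue η ≤ M.effortValue ηstar := hs.2 hη

lemma effortValue_lt (h : M.Regular) {ηstar : ℝ} (hs : M.IsFirstBestEffort ηstar) {η : ℝ}
    (hη : η ∈ Icc (0 : ℝ) 1) (hne : η ≠ ηstar) : M.effortValue η < M.effortValue ηstar := by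
  refine lt_of_le_of_ne (hs.2 hη) fun he => hne ?_
  refine h.strictConcaveOn_effortValue.eq_of_isMaxOn (fun z hz => ?_) hs.2 hη hs.1
  exact (hs.2 hz).trans he.ge

/-- Away from the first-best effort, the loss is bounded below. -/
lemma exists_effortValue_gap (h : M.Regular) {ηstar : ℝ} (hs : M.IsFirstBestEffort ηstar)
    {a b : ℝ} (ha : 0 ≤ a) (ha' : a < ηstar) (hb : ηstar < b) (hb' : b ≤ 1) :
    ∃ γ > 0, ∀ η ∈ Icc (0 : ℝ) 1, η ∉ Icc a b →
      M.effortValue η ≤ M.effortValue ηstar - γ := by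
  have ham : a ∈ Icc (0 : ℝ) 1 := ⟨ha, by linarith [hs.1.2]⟩
  have hbm : b ∈ Icc (0 : ℝ) 1 := ⟨by linarith [hs.1.1], hb'⟩
  have h1 := h.effortValue_lt hs ham ha'.ne
  have h2 := h.effortValue_lt hs hbm hb.ne'
  have hc := h.strictConcaveOn_effortValue.concaveOn
  refine ⟨min (M.effortValue ηstar - M.effortValue a) (M.effortValue ηstar - M.effortValue b),
    lt_min (by linarith) (by linarith), fun η hη hn => ?_⟩
  -- On the way from `η` to the maximizer a concave function never falls below its value at `η`, so
  -- the gaps at `a` and `b` already bound all others.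
  have key : ∀ z ∈ Icc (0 : ℝ) 1, z ∈ segment ℝ η ηstar → M.effortValue η ≤ M.effortValue z := by
    intro z hz hseg
    have := hc.ge_on_segment hη hs.1 hseg
    rwa [min_eq_left (hs.2 hη)] at this
  rcases lt_or_ge η a with hlt | hge
  · have := key a ham (by rw [segment_eq_Icc (by linarith)]; exact ⟨hlt.le, ha'.le⟩)
    linarith [min_le_left (M.effortValue ηstar - M.effortValue a)
      (M.effortValue ηstar - M.effortValue b)]
  · have hgt : b < η := by
      by_contra hle
      exact hn ⟨hge, not_lt.1 hle⟩
    have := key b hbm (by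
      rw [segment_symm, segment_eq_Icc (by linarith)]; exact ⟨hb.le, hgt.le⟩)
    linarith [min_le_right (M.effortValue ηstar - M.effortValue a)
      (M.effortValue ηstar - M.effortValue b)]

/-- Jensen's inequality for the agent: a contract that is individually rational at the effort `η`
pays at least the reservation wage on average. -/
lemma reservationWage_le_expect (h : M.Regular) {n : ℕ} {F : Contract n} {η : ℝ}
    (hη : η ∈ Icc (0 : ℝ) 1) (hir : M.IsIR F η) : M.reservationWage η ≤ M.expect η F := by
  have h1 := h.concaveOn_G.concaveOn.le_map_sum (t := Finset.univ) (p := F)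
    (w := M.outcomeProb η)
    (fun a _ => M.outcomeProb_nonneg (h.passProb_nonneg hη) (h.passProb_le_one hη) a)
    (M.sum_outcomeProb η) (fun _ _ => mem_univ _)
  rw [IsIR, agentValue_eq] at hir
  refine h.strictMono_G.le_iff_le.1 ?_
  rw [(h.reservationWage_spec hη).2]
  simp only [smul_eq_mul] at h1
  have h2 : M.expect η (fun a => M.G (F a)) ≤ M.G (M.expect η F) := h1
  linarith

lemma principalValue_le_effortValue (h : M.Regular) {n : ℕ} {F : Contract n} {η : ℝ}
    (hη : η ∈ Icc (0 : ℝ) 1) (hir : M.IsIR F η) :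
    M.principalValue F η ≤ M.effortValue η := by
  rw [principalValue_eq, effortValue]
  linarith [h.reservationWage_le_expect hη hir]

lemma const_mem_binaryContracts {n : ℕ} {w : ℝ} (hw : w ∈ Icc M.wLow M.wHigh) :
    (fun _ => w) ∈ M.binaryContracts n :=
  M.mem_binaryContracts_iff.2 ⟨fun _ => true, w, w, hw, hw, le_rfl, by simp⟩

lemma isGreatest_firstBestValues (h : M.Regular) {ηstar : ℝ} (hs : M.IsFirstBestEffort ηstar)
    {n : ℕ} {𝓕 : Set (Contract n)} (h𝓕 : M.binaryContracts n ⊆ 𝓕) :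
    IsGreatest (M.firstBestValues 𝓕) (M.effortValue ηstar) := by
  obtain ⟨hw, hw'⟩ := h.reservationWage_spec hs.1
  constructor
  · refine ⟨_, h𝓕 (const_mem_binaryContracts hw), ηstar, hs.1, ?_, ?_⟩
    · rw [IsIR, agentValue_eq, expect_const, hw']
      linarith
    · rw [principalValue_eq, expect_const, effortValue]
  · rintro _ ⟨F, -, η, hη, hir, rfl⟩
    exact (h.principalValue_le_effortValue hη hir).trans (hs.2 hη)

lemma firstBest_eq (h : M.Regular) {ηstar : ℝ} (hs : M.IsFirstBestEffort ηstar)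
    {n : ℕ} {𝓕 : Set (Contract n)} (h𝓕 : M.binaryContracts n ⊆ 𝓕) :
    M.firstBest 𝓕 = M.effortValue ηstar :=
  (h.isGreatest_firstBestValues hs h𝓕).csSup_eq

/-! ### Existence of optimal binary contracts -/

/-- There are finitely many tests, and each contributes a continuous image of the compact set of
ordered wage pairs. -/
lemma isCompact_binaryContracts (M : PAModel) (n : ℕ) : IsCompact (M.binaryContracts n) := by
  have he : M.binaryContracts n = ⋃ Ψ : Outcome n → Bool,
      (fun (w : ℝ × ℝ) (a : Outcome n) => if Ψ a then w.2 else w.1) ''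
        ((Icc M.wLow M.wHigh ×ˢ Icc M.wLow M.wHigh) ∩ {w | w.1 ≤ w.2}) := by
    ext F
    simp only [mem_binaryContracts_iff, mem_iUnion, mem_image, mem_inter_iff, mem_prod,
      mem_ofPred_eq, Prod.exists]
    constructor
    · rintro ⟨Ψ, w₁, w₂, h1, h2, h3, rfl⟩
      exact ⟨Ψ, w₁, w₂, ⟨⟨h1, h2⟩, h3⟩, rfl⟩
    · rintro ⟨Ψ, w₁, w₂, ⟨⟨h1, h2⟩, h3⟩, rfl⟩
      exact ⟨Ψ, w₁, w₂, h1, h2, h3, rfl⟩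
  rw [he]
  refine isCompact_iUnion fun Ψ => IsCompact.image ?_ ?_
  · exact (isCompact_Icc.prod isCompact_Icc).inter_right (isClosed_le continuous_fst continuous_snd)
  · refine continuous_pi fun a => ?_
    by_cases ha : Ψ a
    · simpa [ha] using continuous_snd
    · simpa [ha] using continuous_fst

lemma continuous_outcomeProb (M : PAModel) {n : ℕ} (a : Outcome n) :
    Continuous fun η => M.outcomeProb η a := by
  unfold outcomeProb passProb
  refine continuous_finsetProd _ fun i _ => ?_
  split_ifs <;> fun_prop

lemma continuousOn_agentValue (h : M.Regular) {n : ℕ} :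
    ContinuousOn (fun x : Contract n × ℝ => M.agentValue x.1 x.2) (univ ×ˢ Icc 0 1) := by
  simp only [agentValue_eq]
  refine ContinuousOn.sub (Continuous.continuousOn ?_)
    (h.continuousOn_E.comp continuousOn_snd fun x hx => hx.2)
  refine continuous_finsetSum _ fun a _ => ?_
  exact ((continuous_outcomeProb M a).comp continuous_snd).mul
    (h.continuous_G.comp ((continuous_apply a).comp continuous_fst))

lemma continuousOn_principalValue (h : M.Regular) {n : ℕ} :
    ContinuousOn (fun x : Contract n × ℝ => M.principalValue x.1 x.2) (univ ×ˢ Icc 0 1) := by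
  simp only [principalValue_eq]
  refine ContinuousOn.add (Continuous.continuousOn ?_)
    (h.contDiffOn_μ.continuousOn.comp continuousOn_snd fun x hx => hx.2)
  refine Continuous.neg (continuous_finsetSum _ fun a _ => ?_)
  exact ((continuous_outcomeProb M a).comp continuous_snd).mul
    ((continuous_apply a).comp continuous_fst)

/-- A second-best program with a closed set `T` of admissible efforts has a solution as soon as it
is feasible. -/
lemma exists_optimal_binary (h : M.Regular) {n : ℕ} {T : Set ℝ} (hT : IsClosed T)
    (hne : ∃ F ∈ M.binaryContracts n, ∃ η ∈ T, M.IsIR F η ∧ M.IsIC F η) :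
    ∃ F ∈ M.binaryContracts n, ∃ η ∈ T, (M.IsIR F η ∧ M.IsIC F η) ∧
      ∀ F' ∈ M.binaryContracts n, ∀ η' ∈ T, M.IsIR F' η' → M.IsIC F' η' →
        M.principalValue F' η' ≤ M.principalValue F η := by
  have hK₀c : IsCompact (M.binaryContracts n ×ˢ (Icc 0 1 ∩ T)) :=
    (isCompact_binaryContracts M n).prod (isCompact_Icc.inter_right hT)
  have hsub : M.binaryContracts n ×ˢ (Icc 0 1 ∩ T) ⊆ univ ×ˢ Icc 0 1 :=
    prod_mono (subset_univ _) inter_subset_left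
  generalize hK₀ : M.binaryContracts n ×ˢ (Icc 0 1 ∩ T) = K₀ at hK₀c hsub
  have hcont := h.continuousOn_agentValue (n := n)
  have h1 : IsClosed (K₀ ∩ (fun x => M.agentValue x.1 x.2) ⁻¹' Ici M.U₀) :=
    (hcont.mono hsub).preimage_isClosed_of_isClosed hK₀c.isClosed isClosed_Ici
  -- Incentive compatibility is an intersection of closed conditions, one for each deviation `η'`.
  have h2 : ∀ η' : Icc (0 : ℝ) 1, IsClosed (K₀ ∩
      (fun x => M.agentValue x.1 x.2 - M.agentValue x.1 (η' : ℝ)) ⁻¹' Ici 0) := by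
    intro η'
    have hc' : ContinuousOn (fun x : Contract n × ℝ => M.agentValue x.1 (η' : ℝ)) K₀ :=
      hcont.comp (f := fun x : Contract n × ℝ => (x.1, (η' : ℝ)))
        (by fun_prop) (fun x _ => ⟨mem_univ _, η'.2⟩)
    exact ((hcont.mono hsub).sub hc').preimage_isClosed_of_isClosed hK₀c.isClosed isClosed_Ici
  have hKc := hK₀c.of_isClosed_subset (h1.inter (isClosed_iInter h2)) fun x hx => hx.1.1
  generalize hK : (K₀ ∩ (fun x => M.agentValue x.1 x.2) ⁻¹' Ici M.U₀) ∩
    ⋂ η' : Icc (0 : ℝ) 1, (K₀ ∩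
      (fun x => M.agentValue x.1 x.2 - M.agentValue x.1 (η' : ℝ)) ⁻¹' Ici 0) = K at hKc
  have hKK₀ : K ⊆ K₀ := by
    rw [← hK]
    exact fun x hx => hx.1.1
  have hmem : ∀ F η, (F, η) ∈ K ↔
      F ∈ M.binaryContracts n ∧ η ∈ T ∧ M.IsIR F η ∧ M.IsIC F η := by
    intro F η
    rw [← hK, ← hK₀]
    constructor
    · rintro ⟨⟨⟨hF, hη, hT⟩, hir⟩, hic⟩
      exact ⟨hF, hT, hir, hη, fun η' hη' => sub_nonneg.1 (mem_iInter.1 hic ⟨η', hη'⟩).2⟩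
    · rintro ⟨hF, hT, hir, hη, hic⟩
      exact ⟨⟨⟨hF, hη, hT⟩, hir⟩,
        mem_iInter.2 fun η' => ⟨⟨hF, hη, hT⟩, sub_nonneg.2 (hic η' η'.2)⟩⟩
  obtain ⟨F₀, hF₀, η₀, hη₀, hir₀, hic₀⟩ := hne
  have hcp : ContinuousOn (fun x : Contract n × ℝ => M.principalValue x.1 x.2) K :=
    h.continuousOn_principalValue.mono (hKK₀.trans hsub)
  have hKne : K.Nonempty := ⟨(F₀, η₀), (hmem F₀ η₀).2 ⟨hF₀, hη₀, hir₀, hic₀⟩⟩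
  obtain ⟨x, hx, hmax⟩ := hKc.exists_isMaxOn hKne hcp
  obtain ⟨hF, hη, hir, hic⟩ := (hmem x.1 x.2).1 hx
  exact ⟨x.1, hF, x.2, hη, ⟨hir, hic⟩, fun F' hF' η' hη' hir' hic' =>
    isMaxOn_iff.1 hmax (F', η') ((hmem F' η').2 ⟨hF', hη', hir', hic'⟩)⟩

lemma isGreatest_secondBest (h : M.Regular) (n : ℕ) :
    IsGreatest (M.secondBestValues (M.binaryContracts n))
      (M.secondBest (M.binaryContracts n)) := by
  obtain ⟨hw, hw'⟩ := h.reservationWage_spec (η := 0) (by simp)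
  -- Feasibility: under a constant wage the agent chooses zero effort, and the reservation wage of
  -- zero effort is individually rational.
  obtain ⟨F, hF, η, -, ⟨hir, hic⟩, hmax⟩ := h.exists_optimal_binary (n := n) isClosed_univ
    ⟨_, const_mem_binaryContracts hw, 0, mem_univ _, by
      rw [IsIR, agentValue_eq, expect_const, hw']; linarith, by simp, fun η' hη' => by
      rw [agentValue_eq, agentValue_eq, expect_const, expect_const]
      linarith [h.strictMonoOn_E.monotoneOn (a := 0) (by simp) hη' hη'.1]⟩
  have : IsGreatest (M.secondBestValues (M.binaryContracts n)) (M.principalValue F η) := by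
    refine ⟨⟨F, hF, η, hir, hic, rfl⟩, ?_⟩
    rintro _ ⟨F', hF', η', hir', hic', rfl⟩
    exact hmax F' hF' η' (mem_univ _) hir' hic'
  rw [secondBest, this.csSup_eq]
  exact this

lemma isGreatest_restricted (h : M.Regular) {n : ℕ} {ηstar : ℝ}
    (hne : (M.restrictedValues ηstar (M.binaryContracts n)).Nonempty) :
    IsGreatest (M.restrictedValues ηstar (M.binaryContracts n))
      (M.restrictedSecondBest ηstar (M.binaryContracts n)) := by
  obtain ⟨_, F₀, hF₀, hir₀, hic₀, -⟩ := hne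
  obtain ⟨F, hF, η, hη, ⟨hir, hic⟩, hmax⟩ := h.exists_optimal_binary (n := n)
    (isClosed_singleton (x := ηstar)) ⟨F₀, hF₀, ηstar, rfl, hir₀, hic₀⟩
  obtain rfl : η = ηstar := hη
  have : IsGreatest (M.restrictedValues η (M.binaryContracts n)) (M.principalValue F η) := by
    refine ⟨⟨F, hF, hir, hic, rfl⟩, ?_⟩
    rintro _ ⟨F', hF', hir', hic', rfl⟩
    exact hmax F' hF' η rfl hir' hic'
  rw [restrictedSecondBest, this.csSup_eq]
  exact this

end Regular

/-! ### The score: tail bounds and the least error probability of a responsive test -/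

/-- The score of a single sample: the derivative of the log-likelihood in the effort. -/
def sampleScore (M : PAModel) (η : ℝ) (x : Bool) : ℝ :=
  if x then M.c / 2 / M.passProb η else -(M.c / 2 / (1 - M.passProb η))

/-- The score of the data. -/
def score (M : PAModel) {n : ℕ} (η : ℝ) (a : Outcome n) : ℝ := ∑ i, M.sampleScore η (a i)

lemma hasDerivAt_passProb (M : PAModel) (η : ℝ) : HasDerivAt M.passProb (M.c / 2) η := by
  have := (((hasDerivAt_id η).const_mul M.c).const_add 1).div_const 2
  rw [mul_one] at this
  exact this

lemma hasDerivAt_outcomeProb (M : PAModel) {n : ℕ} {η : ℝ} (h₀ : M.passProb η ≠ 0)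
    (h₁ : 1 - M.passProb η ≠ 0) (a : Outcome n) :
    HasDerivAt (fun η => M.outcomeProb η a) (M.outcomeProb η a * M.score η a) η := by
  have hi : ∀ i ∈ (Finset.univ : Finset (Fin n)),
      HasDerivAt (fun η => if a i then M.passProb η else 1 - M.passProb η)
        ((if a i then M.passProb η else 1 - M.passProb η) * M.sampleScore η (a i)) η := by
    intro i _
    cases hai : a i
    · simp only [sampleScore, Bool.false_eq_true, if_false]
      refine ((M.hasDerivAt_passProb η).const_sub 1).congr_deriv ?_
      rw [mul_neg, mul_div_cancel₀ _ h₁]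
    · simp only [sampleScore, if_true]
      refine (M.hasDerivAt_passProb η).congr_deriv ?_
      rw [mul_div_cancel₀ _ h₀]
  refine (HasDerivAt.fun_finsetProd hi).congr_deriv ?_
  rw [score, Finset.mul_sum]
  refine Finset.sum_congr rfl fun i hi' => ?_
  rw [smul_eq_mul, ← mul_assoc, Finset.prod_erase_mul _ _ hi']
  rfl

lemma hasDerivAt_passTest (M : PAModel) {n : ℕ} {η : ℝ} (h₀ : M.passProb η ≠ 0)
    (h₁ : 1 - M.passProb η ≠ 0) (Ψ : Outcome n → Bool) :
    HasDerivAt (M.passTest Ψ) (M.expect η fun a => if Ψ a then M.score η a else 0) η := by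
  refine (HasDerivAt.fun_sum (u := Finset.univ) fun (a : Outcome n) _ =>
    (M.hasDerivAt_outcomeProb h₀ h₁ a).mul_const (if Ψ a then (1 : ℝ) else 0)).congr_deriv ?_
  refine Finset.sum_congr rfl fun a _ => ?_
  cases hΨ : Ψ a <;> simp [hΨ]

/-- This says that the score has mean zero. It follows by differentiating the identity between the
passing probabilities of a test and its negation. -/
lemma expect_score_not (M : PAModel) {n : ℕ} {η : ℝ} (h₀ : M.passProb η ≠ 0)
    (h₁ : 1 - M.passProb η ≠ 0) (Ψ : Outcome n → Bool) :
    (M.expect η fun a => if !Ψ a then M.score η a else 0)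
      = - M.expect η fun a => if Ψ a then M.score η a else 0 := by
  refine (M.hasDerivAt_passTest h₀ h₁ fun a => !Ψ a).unique ?_
  have := (M.hasDerivAt_passTest h₀ h₁ Ψ).const_sub 1
  refine this.congr_of_eventuallyEq (Eventually.of_forall fun x => ?_)
  exact M.passTest_not Ψ x

lemma exp_le_one_add_add_sq {x : ℝ} (hx : |x| ≤ 1) : Real.exp x ≤ 1 + x + x ^ 2 := by
  have := (abs_le.1 (Real.abs_exp_sub_one_sub_id_le hx)).2
  linarith

/-- The score has sub-Gaussian tails. -/
lemma expect_exp_score_le (M : PAModel) (hc₀ : 0 ≤ M.c) (hc₁ : M.c ≤ 1) {n : ℕ} {η β t : ℝ}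
    (hβ : 0 < β) (h₀ : β ≤ M.passProb η) (h₁ : β ≤ 1 - M.passProb η)
    (ht : |t| * (1 / (2 * β)) ≤ 1) :
    (M.expect η fun a : Outcome n => Real.exp (t * M.score η a))
      ≤ Real.exp (n * (t * (1 / (2 * β))) ^ 2) := by
  set p := M.passProb η with hp
  -- By independence the moment generating function is the n-th power of that of one sample.
  have e : (M.expect η fun a : Outcome n => Real.exp (t * M.score η a)) =
      (p * Real.exp (t * M.sampleScore η true) +
        (1 - p) * Real.exp (t * M.sampleScore η false)) ^ n := by
    rw [expect]
    have := sum_prod_outcome (n := n) fun b =>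
      (if b then p else 1 - p) * Real.exp (t * M.sampleScore η b)
    simp only [if_true, Bool.false_eq_true, if_false] at this
    rw [← this]
    refine Finset.sum_congr rfl fun a _ => ?_
    rw [Finset.prod_mul_distrib, ← Real.exp_sum, ← Finset.mul_sum]
    rfl
  have hs : ∀ b, |M.sampleScore η b| ≤ 1 / (2 * β) := by
    have key : ∀ q, β ≤ q → M.c / 2 / q ≤ 1 / (2 * β) := fun q hq => by
      rw [div_div]
      exact div_le_div₀ zero_le_one hc₁ (by positivity) (by linarith)
    intro b
    cases b
    · simp only [sampleScore, Bool.false_eq_true, if_false, abs_neg]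
      rw [abs_of_nonneg (div_nonneg (by linarith) (by linarith))]
      exact key _ h₁
    · simp only [sampleScore, if_true]
      rw [abs_of_nonneg (div_nonneg (by linarith) (by linarith))]
      exact key _ h₀
  have hexp : ∀ b, Real.exp (t * M.sampleScore η b)
      ≤ 1 + t * M.sampleScore η b + (t * (1 / (2 * β))) ^ 2 := by
    intro b
    have h1 : |t * M.sampleScore η b| ≤ |t| * (1 / (2 * β)) := by
      rw [abs_mul]
      exact mul_le_mul_of_nonneg_left (hs b) (abs_nonneg _)
    have h2 : (t * M.sampleScore η b) ^ 2 ≤ (t * (1 / (2 * β))) ^ 2 := by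
      rw [sq_le_sq, abs_mul t (1 / (2 * β)), abs_of_pos (show 0 < 1 / (2 * β) by positivity)]
      exact h1
    linarith [exp_le_one_add_add_sq (h1.trans ht)]
  rw [e, Real.exp_nat_mul]
  have hp0 : 0 < p := by linarith
  have hp1 : 0 < 1 - p := by linarith
  refine pow_le_pow_left₀ (by positivity) ?_ n
  have hmean : p * M.sampleScore η true + (1 - p) * M.sampleScore η false = 0 := by
    simp only [sampleScore, if_true, Bool.false_eq_true, if_false, ← hp]
    field_simp
    ring
  calc _ ≤ p * (1 + t * M.sampleScore η true + (t * (1 / (2 * β))) ^ 2)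
        + (1 - p) * (1 + t * M.sampleScore η false + (t * (1 / (2 * β))) ^ 2) := by
        gcongr
        · exact hexp true
        · exact hexp false
    _ = (t * (1 / (2 * β))) ^ 2 + 1 := by linear_combination t * hmean
    _ ≤ _ := Real.add_one_le_exp _

/-- An event on which the score has a large mean cannot have a very small probability. -/
lemma mul_expect_score_le (M : PAModel) (hc₀ : 0 ≤ M.c) (hc₁ : M.c ≤ 1) {n : ℕ} {η β t : ℝ}
    (hβ : 0 < β) (h₀ : β ≤ M.passProb η) (h₁ : β ≤ 1 - M.passProb η)
    (ht : |t| * (1 / (2 * β)) ≤ 1) (A : ℝ) (Ψ : Outcome n → Bool) :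
    t * (M.expect η fun a => if Ψ a then M.score η a else 0)
      ≤ Real.exp (n * (t * (1 / (2 * β))) ^ 2 - A) + A * M.passTest Ψ η := by
  -- On the event this is x ≤ exp (x - A) + A for x = t * score; off the event the right side is
  -- nonnegative.
  have h := M.expect_mono (n := n) (by linarith) (by linarith)
    (X := fun a => t * if Ψ a then M.score η a else 0)
    (Y := fun a => Real.exp (-A) * Real.exp (t * M.score η a) + A * if Ψ a then 1 else 0)
    (η := η) fun a => by
      rw [← Real.exp_add]
      split_ifs
      · linarith [Real.add_one_le_exp (-A + t * M.score η a)]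
      · simp only [mul_zero, add_zero]
        positivity
  rw [expect_const_mul, expect_add, expect_const_mul, expect_const_mul] at h
  refine h.trans (add_le_add ?_ le_rfl)
  rw [sub_eq_add_neg, add_comm, Real.exp_add]
  exact mul_le_mul_of_nonneg_left (M.expect_exp_score_le hc₀ hc₁ hβ h₀ h₁ ht)
    (Real.exp_pos _).le

lemma tendsto_sqrt_log_div : Tendsto (fun n : ℕ => Real.sqrt (Real.log n / n)) atTop (𝓝 0) := by
  have h := (Real.isLittleO_log_id_atTop.tendsto_div_nhds_zero).comp tendsto_natCast_atTop_atTop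
  have := (Real.continuous_sqrt.tendsto 0).comp h
  rw [Real.sqrt_zero] at this
  exact this

lemma eventually_log_ge (C : ℝ) : ∀ᶠ n : ℕ in atTop, C ≤ Real.log n :=
  (Real.tendsto_log_atTop.comp tendsto_natCast_atTop_atTop).eventually_ge_atTop C

/-- If the passing probability of a test reacts to the effort, then the test has errors of both
kinds with probability at least of the order `1 / √(n log n)`. -/
lemma exists_passTest_lower (M : PAModel) (hc₀ : 0 ≤ M.c) (hc₁ : M.c ≤ 1) {β e : ℝ}
    (hβ : 0 < β) (he : 0 < e) :
    ∃ κ > 0, ∀ᶠ n : ℕ in atTop, ∀ (Ψ : Outcome n → Bool) (η : ℝ), β ≤ M.passProb η →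
      β ≤ 1 - M.passProb η → e ≤ (M.expect η fun a => if Ψ a then M.score η a else 0) →
        κ / Real.sqrt (n * Real.log n) ≤ M.passTest Ψ η ∧
        κ / Real.sqrt (n * Real.log n) ≤ 1 - M.passTest Ψ η := by
  set K := 1 / (2 * β) with hK
  have hK0 : 0 < K := by positivity
  refine ⟨e / (2 * (K ^ 2 + 1)), by positivity, ?_⟩
  filter_upwards [eventually_log_ge 1, eventually_gt_atTop 0,
    tendsto_sqrt_log_div.eventually_le_const (show 0 < 1 / K by positivity),
    tendsto_sqrt_log_div.eventually_le_const (show 0 < e / 2 by positivity)] with n hL hn hs1 hs2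
  set L := Real.log n with hLdef
  set t := Real.sqrt (L / n) with ht
  set r := Real.sqrt (n * L) with hr
  have hn' : (0 : ℝ) < n := by exact_mod_cast hn
  have hL0 : 0 < L := by linarith
  have ht2 : t ^ 2 = L / n := Real.sq_sqrt (by positivity)
  have hr0 : 0 < r := Real.sqrt_pos.2 (by positivity)
  have htr : t = L / r := by
    rw [ht, hr, Real.sqrt_div hL0.le, Real.sqrt_mul hn'.le, eq_div_iff (by positivity)]
    have h1 : Real.sqrt n ≠ 0 := (Real.sqrt_pos.2 hn').ne'
    field_simp
    rw [Real.sq_sqrt hL0.le]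
  have hrn : r = t * n := by
    have : r ^ 2 = n * L := Real.sq_sqrt (by positivity)
    rw [eq_div_iff hr0.ne'] at htr
    have h2 : r * r = (t * n) * r := by
      calc r * r = n * L := by rw [← sq, this]
        _ = n * (t * r) := by rw [htr]
        _ = _ := by ring
    exact mul_right_cancel₀ hr0.ne' h2
  -- The sign `s` covers both errors: `s = 1` is used for `Ψ`, and `s = -1` for its negation, on
  -- which the mean of the score is reversed.
  have main : ∀ (Ψ : Outcome n → Bool) (η s : ℝ), |s| = 1 → β ≤ M.passProb η →
      β ≤ 1 - M.passProb η → e ≤ s * (M.expect η fun a => if Ψ a then M.score η a else 0) →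
        e / (2 * (K ^ 2 + 1)) / r ≤ M.passTest Ψ η := by
    intro Ψ η s hs h0 h1 hes
    have ht0 : 0 ≤ t := Real.sqrt_nonneg _
    have hst : |s * t| * K ≤ 1 := by
      rw [abs_mul, hs, one_mul, abs_of_nonneg ht0]
      calc t * K ≤ 1 / K * K := by gcongr
        _ = 1 := by field_simp
    -- As t² = L / n, the variance term is K² L, and this choice of `A` leaves exp (-L) = 1 / n.
    have h := M.mul_expect_score_le hc₀ hc₁ hβ h0 h1 hst ((K ^ 2 + 1) * L) Ψ
    have hs2' : s ^ 2 = 1 := by rw [← sq_abs, hs]; norm_num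
    have hexp : Real.exp (n * (s * t * K) ^ 2 - (K ^ 2 + 1) * L) = 1 / n := by
      have : (n : ℝ) * (s * t * K) ^ 2 - (K ^ 2 + 1) * L = - L := by
        rw [mul_pow, mul_pow, hs2', ht2]
        field_simp
        ring
      rw [this, Real.exp_neg, hLdef, Real.exp_log hn', one_div]
    rw [← hK, hexp] at h
    have h' : t * e ≤ 1 / n + (K ^ 2 + 1) * L * M.passTest Ψ η := by
      refine le_trans ?_ h
      calc t * e ≤ t * (s * _) := mul_le_mul_of_nonneg_left hes ht0
        _ = _ := by ring
    -- Since L ≥ 1, 1 / n ≤ t², and t ≤ e / 2 for large n. The exponential term thus uses up at most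
    -- half of t e.
    have h3 : 1 / (n : ℝ) ≤ t * e / 2 := by
      have : r / n = t := by rw [hrn]; field_simp
      rw [div_le_iff₀ hn']
      have h4 : L = t ^ 2 * n := by rw [ht2]; field_simp
      have h5 : 1 ≤ t * t * n := by nlinarith
      calc 1 ≤ t * t * n := h5
        _ ≤ t * (e / 2) * n := by gcongr
        _ = _ := by ring
    rw [div_div, div_le_iff₀ (by positivity)]
    have h6 : t * e / 2 ≤ (K ^ 2 + 1) * L * M.passTest Ψ η := by linarith
    rw [htr] at h6
    have h7 : L * (e / 2) ≤ L * ((K ^ 2 + 1) * M.passTest Ψ η * r) := by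
      have := mul_le_mul_of_nonneg_right h6 hr0.le
      have h8 : L / r * e / 2 * r = L * (e / 2) := by field_simp
      linarith
    have := le_of_mul_le_mul_left h7 hL0
    linarith
  intro Ψ η h0 h1 hes
  refine ⟨main Ψ η 1 (by simp) h0 h1 (by simpa using hes), ?_⟩
  rw [← M.passTest_not]
  refine main _ η (-1) (by simp) h0 h1 ?_
  rw [M.expect_score_not (by linarith) (by linarith)]
  linarith

/-! ### The risk premium and the upper bound on the second-best value -/

namespace Regular

variable {M : PAModel}

lemma exists_deriv_G_bounds (h : M.Regular) : ∃ l L : ℝ, 0 < l ∧ 0 < L ∧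
    ∀ x ∈ Icc M.wLow M.wHigh, ∀ y ∈ Icc M.wLow M.wHigh, x ≤ y →
      l * (y - x) ≤ M.G y - M.G x ∧ M.G y - M.G x ≤ L * (y - x) := by
  have hc : ContinuousOn (deriv M.G) (Icc M.wLow M.wHigh) :=
    h.contDiff_deriv_G.continuous.continuousOn
  have hne : (Icc M.wLow M.wHigh).Nonempty := nonempty_Icc.2 h.wLow_lt_wHigh.le
  obtain ⟨x₁, -, hx₁⟩ := isCompact_Icc.exists_isMinOn hne hc
  obtain ⟨x₂, -, hx₂⟩ := isCompact_Icc.exists_isMaxOn hne hc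
  refine ⟨deriv M.G x₁, deriv M.G x₂, h.deriv_G_pos _, h.deriv_G_pos _, fun x hx y hy hxy => ?_⟩
  have hd := h.differentiable_G.differentiableOn (s := interior (Icc M.wLow M.wHigh))
  exact ⟨(convex_Icc _ _).mul_sub_le_image_sub_of_le_deriv h.continuous_G.continuousOn hd
      (fun z hz => hx₁ (interior_subset hz)) x hx y hy hxy,
    (convex_Icc _ _).image_sub_le_mul_sub_of_deriv_le h.continuous_G.continuousOn hd
      (fun z hz => hx₂ (interior_subset hz)) x hx y hy hxy⟩

/-- Strong concavity of the monetary utility on the wage range. -/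
lemma exists_strong_concave_G (h : M.Regular) : ∃ m > 0,
    ∀ x ∈ Icc M.wLow M.wHigh, ∀ y ∈ Icc M.wLow M.wHigh, ∀ t ∈ Icc (0 : ℝ) 1,
      M.G x + (M.G y - M.G x) * t + m * (t * (1 - t) * (y - x) ^ 2)
        ≤ M.G (x + (y - x) * t) := by
  have hc : ContinuousOn (deriv (deriv M.G)) (Icc M.wLow M.wHigh) :=
    (h.contDiff_deriv_G.continuous_deriv (by norm_num)).continuousOn
  have hne : (Icc M.wLow M.wHigh).Nonempty := nonempty_Icc.2 h.wLow_lt_wHigh.le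
  obtain ⟨x₁, -, hx₁⟩ := isCompact_Icc.exists_isMaxOn hne hc
  -- `x₁` maximizes G'', so this is the largest m for which G'' + 2 m ≤ 0 on the wage range, that
  -- is, for which the derivative test makes G + m x² concave.
  set m := -deriv (deriv M.G) x₁ / 2 with hm
  have hm0 : 0 < m := by have := h.deriv2_G_neg x₁; linarith
  have hd1 : ∀ x, HasDerivAt (fun x => M.G x + m * x ^ 2) (deriv M.G x + m * (2 * x)) x := by
    intro x
    have := (h.differentiable_G x).hasDerivAt.add ((hasDerivAt_pow 2 x).const_mul m)
    refine this.congr_deriv ?_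
    norm_num
  have hd1' : deriv (fun x => M.G x + m * x ^ 2) = fun x => deriv M.G x + m * (2 * x) :=
    funext fun x => (hd1 x).deriv
  have hd2 : ∀ x, HasDerivAt (fun x => deriv M.G x + m * (2 * x))
      (deriv (deriv M.G) x + m * 2) x := by
    intro x
    have := ((h.contDiff_deriv_G.differentiable (by norm_num)) x).hasDerivAt.add
      (((hasDerivAt_id x).const_mul 2).const_mul m)
    refine this.congr_deriv ?_
    norm_num
  have hconc : ConcaveOn ℝ (Icc M.wLow M.wHigh) fun x => M.G x + m * x ^ 2 := by
    refine concaveOn_of_deriv2_nonpos (convex_Icc _ _)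
      (fun x _ => (hd1 x).continuousAt.continuousWithinAt)
      (fun x _ => (hd1 x).differentiableAt.differentiableWithinAt) ?_ ?_
    · rw [hd1']
      exact fun x _ => (hd2 x).differentiableAt.differentiableWithinAt
    · intro x hx
      rw [Function.iterate_succ, Function.iterate_one, Function.comp_apply, hd1', (hd2 x).deriv]
      have := hx₁ (interior_subset hx)
      simp only [mem_ofPred_eq] at this
      linarith
  refine ⟨m, hm0, fun x hx y hy t ht => ?_⟩
  have := hconc.2 hx hy (sub_nonneg.2 ht.2) ht.1 (by ring)
  simp only [smul_eq_mul] at this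
  have e : (1 - t) * x + t * y = x + (y - x) * t := by ring
  rw [e] at this
  linear_combination this

/-- The risk premium of a binary contract. -/
lemma exists_risk_premium (h : M.Regular) : ∃ m > 0, ∀ (n : ℕ) (Ψ : Outcome n → Bool) (w₁ w₂ η : ℝ),
    w₁ ∈ Icc M.wLow M.wHigh → w₂ ∈ Icc M.wLow M.wHigh → w₁ ≤ w₂ → η ∈ Icc (0 : ℝ) 1 →
    M.IsIR (fun a => if Ψ a then w₂ else w₁) η →
      M.principalValue (fun a => if Ψ a then w₂ else w₁) η ≤ M.effortValue η -
        m * (M.passTest Ψ η * (1 - M.passTest Ψ η) * (M.G w₂ - M.G w₁) ^ 2) := by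
  obtain ⟨l, L, hl, hL, hG⟩ := h.exists_deriv_G_bounds
  obtain ⟨m, hm, hsc⟩ := h.exists_strong_concave_G
  -- The factor L² converts the wage spread into the utility spread; the last L converts the utility
  -- premium into wages.
  refine ⟨m / L ^ 2 / L, by positivity, fun n Ψ w₁ w₂ η hw₁ hw₂ hw hη hir => ?_⟩
  have hp0 := M.passTest_nonneg (h.passProb_nonneg hη) (h.passProb_le_one hη) Ψ
  have hp1 := M.passTest_nonneg (h.passProb_nonneg hη) (h.passProb_le_one hη) fun a => !Ψ a
  rw [passTest_not] at hp1
  rw [principalValue_ite]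
  rw [IsIR, agentValue_ite] at hir
  generalize M.passTest Ψ η = P at *
  have hJ := hsc w₁ hw₁ w₂ hw₂ P ⟨hp0, by linarith⟩
  have hwbarm : w₁ + (w₂ - w₁) * P ∈ Icc M.wLow M.wHigh := by
    have := hw₁.1
    have := hw₂.2
    constructor
    · linarith [mul_nonneg (sub_nonneg.2 hw) hp0]
    · linarith [mul_le_of_le_one_right (sub_nonneg.2 hw) (sub_nonneg.1 hp1)]
  obtain ⟨hr0m, hr0⟩ := h.reservationWage_spec hη
  have hdef : M.effortValue η = -M.reservationWage η + M.μ η := rfl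
  generalize w₁ + (w₂ - w₁) * P = wbar at *
  have hΔ : 0 ≤ M.G w₂ - M.G w₁ := sub_nonneg.2 (h.strictMono_G.monotone hw)
  have hsq : m / L ^ 2 * (P * (1 - P) * (M.G w₂ - M.G w₁) ^ 2)
      ≤ m * (P * (1 - P) * (w₂ - w₁) ^ 2) := by
    have h1 := pow_le_pow_left₀ hΔ (hG w₁ hw₁ w₂ hw₂ hw).2 2
    calc _ ≤ m / L ^ 2 * (P * (1 - P) * (L * (w₂ - w₁)) ^ 2) := by gcongr
      _ = _ := by field_simp
  have hle : M.reservationWage η ≤ wbar := by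
    refine h.strictMono_G.le_iff_le.1 ?_
    have : 0 ≤ m * (P * (1 - P) * (w₂ - w₁) ^ 2) := by positivity
    linarith
  have hfin := (hG _ hr0m _ hwbarm hle).2
  have : m / L ^ 2 / L * (P * (1 - P) * (M.G w₂ - M.G w₁) ^ 2) ≤ wbar - M.reservationWage η := by
    rw [div_mul_eq_mul_div, div_le_iff₀ hL]
    linarith
  linarith

/-- No binary contract is better than the first-best value minus `κ / √(n log n)`. -/
lemma exists_secondBest_le (h : M.Regular) {ηstar : ℝ} (hs : M.IsFirstBestEffort ηstar)
    (hs' : ηstar ∈ Ioo (0 : ℝ) 1) : ∃ κ > 0, ∀ᶠ n : ℕ in atTop,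
      M.secondBest (M.binaryContracts n) ≤
        M.effortValue ηstar - κ / Real.sqrt (n * Real.log n) := by
  obtain ⟨hs0, hs1⟩ := hs'
  set a := ηstar / 2 with ha
  set b := (1 + ηstar) / 2 with hb
  have haIoo : a ∈ Ioo (0 : ℝ) 1 := ⟨by linarith, by linarith⟩
  have hbIoo : b ∈ Ioo (0 : ℝ) 1 := ⟨by linarith, by linarith⟩
  have hc0 := h.c_pos
  obtain ⟨γ, hγ, hgap⟩ := h.exists_effortValue_gap hs (a := a) (b := b) haIoo.1.le
    (by linarith) (by linarith) hbIoo.2.le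
  obtain ⟨m, hm, hrisk⟩ := h.exists_risk_premium
  set e₁ := deriv M.E a with he₁
  have he₁0 : 0 < e₁ := h.deriv_E_pos a haIoo
  set d := M.E a - M.E 0 with hd
  have hd0 : 0 < d := sub_pos.2 (h.strictMonoOn_E (by simp) (Ioo_subset_Icc_self haIoo) haIoo.1)
  set R := M.G M.wHigh - M.G M.wLow with hR
  have hR0 : 0 < R := sub_pos.2 (h.strictMono_G h.wLow_lt_wHigh)
  -- Both outcomes of a sample have probability at least β for all efforts in [a, b]. Keeping away
  -- from effort 1 matters when c = 1.
  set β := min (1 / 2 : ℝ) (1 - M.passProb b) with hβ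
  have hβ0 : 0 < β := by
    refine lt_min (by norm_num) ?_
    unfold passProb
    nlinarith [h.c_le, hbIoo.1, hbIoo.2]
  obtain ⟨κ, hκ, hev⟩ := M.exists_passTest_lower hc0.le h.c_le hβ0 (div_pos he₁0 hR0)
  set κ' := m * (κ / 2 * d ^ 2) with hκ'
  have hκ'0 : 0 < κ' := by positivity
  refine ⟨min γ κ', lt_min hγ hκ'0, ?_⟩
  filter_upwards [hev, eventually_log_ge 1, eventually_ge_atTop 1] with n hn hlog hn1
  have hn1' : (1 : ℝ) ≤ n := by exact_mod_cast hn1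
  set r := Real.sqrt (n * Real.log n) with hr
  have hr1 : 1 ≤ r := by
    rw [hr]
    exact Real.one_le_sqrt.2 (one_le_mul_of_one_le_of_one_le hn1' hlog)
  obtain ⟨F, hF, η, hir, hic, hv⟩ := (h.isGreatest_secondBest n).1
  rw [hv]
  have hη := hic.1
  by_cases hab : η ∈ Icc a b
  swap
  · have h1 := h.principalValue_le_effortValue hη hir
    have h2 := hgap η hη hab
    have h3 : min γ κ' / r ≤ γ := by
      refine (div_le_self (lt_min hγ hκ'0).le hr1).trans (min_le_left _ _)
    linarith
  obtain ⟨Ψ, w₁, w₂, hw₁, hw₂, hw, rfl⟩ := M.mem_binaryContracts_iff.1 hF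
  have hηo : η ∈ Ioo (0 : ℝ) 1 := ⟨haIoo.1.trans_le hab.1, hab.2.trans_lt hbIoo.2⟩
  have hp0 : β ≤ M.passProb η := (min_le_left _ _).trans (h.passProb_mem hη).1
  have hp1 : β ≤ 1 - M.passProb η := by
    refine (min_le_right _ _).trans ?_
    unfold passProb
    nlinarith [hab.2]
  set P := M.passTest Ψ η with hP
  set Δ := M.G w₂ - M.G w₁ with hΔ
  have hΔ0 : 0 ≤ Δ := sub_nonneg.2 (h.strictMono_G.monotone hw)
  have hΔR : Δ ≤ R := sub_le_sub (h.strictMono_G.monotone hw₂.2) (h.strictMono_G.monotone hw₁.1)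
  have hder := M.hasDerivAt_passTest (by linarith) (by linarith) Ψ (η := η)
  set q := M.expect η fun a => if Ψ a then M.score η a else 0 with hq
  -- An incentive-compatible effort in the interior satisfies the agent's first-order condition.
  have hfoc : Δ * q - deriv M.E η = 0 := by
    have hmax : IsLocalMax (fun η => M.G w₁ + Δ * M.passTest Ψ η - M.E η) η := by
      filter_upwards [Icc_mem_nhds hηo.1 hηo.2] with z hz
      have := hic.2 z hz
      rwa [agentValue_ite, agentValue_ite] at this
    exact hmax.hasDerivAt_eq_zero
      (((hder.const_mul Δ).const_add _).sub (h.hasDerivAt_E hηo))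
  have hEη : e₁ ≤ deriv M.E η := h.monotoneOn_deriv_E haIoo hηo hab.1
  have hΔq : e₁ ≤ Δ * q := by linarith
  have hq0 : 0 < q := by
    by_contra hneg
    nlinarith
  have hqR : e₁ / R ≤ q := by
    rw [div_le_iff₀ hR0]
    nlinarith
  obtain ⟨hP1, hP2⟩ := hn Ψ η hp0 hp1 hqR
  have hP0 : 0 ≤ P := le_trans (by positivity) hP1
  have hP3 : P ≤ 1 := by
    have : 0 ≤ κ / r := by positivity
    linarith
  -- Deviating to zero effort saves at least `d` and forfeits at most `Δ`.
  have hΔd : d ≤ Δ := by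
    have h0 := hic.2 0 (by simp)
    rw [agentValue_ite, agentValue_ite] at h0
    have h0m : (0 : ℝ) ∈ Icc (0 : ℝ) 1 := by simp
    have hpt0 : 0 ≤ M.passTest Ψ 0 :=
      M.passTest_nonneg (h.passProb_nonneg h0m) (h.passProb_le_one h0m) Ψ
    have hE : M.E a ≤ M.E η := h.strictMonoOn_E.monotoneOn (Ioo_subset_Icc_self haIoo) hη hab.1
    linarith [mul_nonneg hΔ0 hpt0, mul_le_of_le_one_right hΔ0 hP3]
  have hPP : κ / 2 / r ≤ P * (1 - P) := by
    rcases le_total P (1 / 2) with hle | hle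
    · have h1 : κ / r * (1 / 2) ≤ P * (1 - P) :=
        mul_le_mul hP1 (by linarith) (by norm_num) hP0
      calc _ = κ / r * (1 / 2) := by ring
        _ ≤ _ := h1
    · have h1 : 1 / 2 * (κ / r) ≤ P * (1 - P) :=
        mul_le_mul hle hP2 (by positivity) hP0
      calc _ = 1 / 2 * (κ / r) := by ring
        _ ≤ _ := h1
  have hloss : κ' / r ≤ m * (P * (1 - P) * Δ ^ 2) := by
    have h1 : κ / 2 / r * d ^ 2 ≤ P * (1 - P) * Δ ^ 2 :=
      mul_le_mul hPP (pow_le_pow_left₀ hd0.le hΔd 2) (by positivity)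
        (mul_nonneg hP0 (by linarith))
    calc _ = m * (κ / 2 / r * d ^ 2) := by rw [hκ']; ring
      _ ≤ _ := mul_le_mul_of_nonneg_left h1 hm.le
  have hmin : min γ κ' / r ≤ κ' / r := by
    gcongr
    exact min_le_right _ _
  linarith [hrisk n Ψ w₁ w₂ η hw₁ hw₂ hw hη hir, effortValue_le hs hη]

end Regular
end PAModel

/-! ### Binomial probabilities and the choice of the threshold -/

/-- The binomial probability of `j` successes in `n` trials with success probability `x`. -/
def binomProb (n j : ℕ) (x : ℝ) : ℝ := n.choose j * x ^ j * (1 - x) ^ (n - j)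

lemma eval_bernsteinPolynomial (n j : ℕ) (x : ℝ) :
    (bernsteinPolynomial ℝ n j).eval x = binomProb n j x := by
  simp [bernsteinPolynomial, binomProb]

lemma binomProb_nonneg {x : ℝ} (h₀ : 0 ≤ x) (h₁ : x ≤ 1) (n j : ℕ) : 0 ≤ binomProb n j x := by
  have : 0 ≤ 1 - x := by linarith
  unfold binomProb
  positivity

lemma binomProb_of_lt {n j : ℕ} (hj : n < j) (x : ℝ) : binomProb n j x = 0 := by
  simp [binomProb, Nat.choose_eq_zero_of_lt hj]

lemma sum_binomProb (n : ℕ) (x : ℝ) : ∑ j ∈ Finset.range (n + 1), binomProb n j x = 1 := by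
  have := congrArg (Polynomial.eval x) (bernsteinPolynomial.sum ℝ n)
  simpa [Polynomial.eval_finsetSum, eval_bernsteinPolynomial] using this

lemma variance_binomProb (n : ℕ) (x : ℝ) :
    ∑ j ∈ Finset.range (n + 1), (n * x - j) ^ 2 * binomProb n j x = n * x * (1 - x) := by
  have := congrArg (Polynomial.eval x) (bernsteinPolynomial.variance ℝ n)
  simpa [Polynomial.eval_finsetSum, eval_bernsteinPolynomial] using this

/-- The ratio of consecutive probabilities, free of division. The monotonicity and geometric decay
estimates rest on it. -/
lemma binomProb_succ (n j : ℕ) (hj : j < n) (x : ℝ) :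
    binomProb n (j + 1) x * ((j + 1) * (1 - x)) = binomProb n j x * ((n - j) * x) := by
  have h := Nat.choose_succ_right_eq n j
  have h' : (n.choose (j + 1) : ℝ) * (j + 1) = n.choose j * (n - j) := by
    have := congrArg (Nat.cast : ℕ → ℝ) h
    push_cast [Nat.cast_sub hj.le] at this
    exact this
  have e : n - j = (n - (j + 1)) + 1 := by omega
  unfold binomProb
  rw [e, pow_succ (1 - x), pow_succ x]
  linear_combination x ^ j * x * (1 - x) ^ (n - (j + 1)) * (1 - x) * h'

/-- Chebyshev's inequality for binomial probabilities. -/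
lemma sum_binomProb_far_le {n : ℕ} {x R : ℝ} (h₀ : 0 ≤ x) (h₁ : x ≤ 1) (hR : 0 < R)
    {s : Finset ℕ} (hs : s ⊆ Finset.range (n + 1)) (hfar : ∀ j ∈ s, R ≤ |n * x - j|) :
    ∑ j ∈ s, binomProb n j x ≤ n / (4 * R ^ 2) := by
  have h1 : ∑ j ∈ s, R ^ 2 * binomProb n j x ≤ n * x * (1 - x) := by
    rw [← variance_binomProb]
    refine (Finset.sum_le_sum fun j hj => ?_).trans
      (Finset.sum_le_sum_of_subset_of_nonneg hs fun j _ _ =>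
        mul_nonneg (sq_nonneg _) (binomProb_nonneg h₀ h₁ n j))
    refine mul_le_mul_of_nonneg_right ?_ (binomProb_nonneg h₀ h₁ n j)
    rw [← sq_abs (n * x - j)]
    exact pow_le_pow_left₀ hR.le (hfar j hj) 2
  rw [← Finset.mul_sum] at h1
  rw [le_div_iff₀ (by positivity)]
  have h2 : n * x * (1 - x) ≤ n / 4 := by
    have : x * (1 - x) ≤ 1 / 4 := by nlinarith [sq_nonneg (x - 1 / 2)]
    calc n * x * (1 - x) = n * (x * (1 - x)) := by ring
      _ ≤ n * (1 / 4) := by gcongr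
      _ = _ := by ring
  linarith

lemma binomProb_le_succ {n j : ℕ} {x : ℝ} (h₀ : 0 < x) (h₁ : x < 1)
    (h : (j + 1 : ℝ) ≤ (n + 1) * x) : binomProb n j x ≤ binomProb n (j + 1) x := by
  have hjn : j < n := by
    have : (j + 1 : ℝ) < n + 1 := h.trans_lt (mul_lt_of_lt_one_right (by positivity) h₁)
    exact_mod_cast (by linarith : (j : ℝ) < n)
  have hjn' : (j : ℝ) < n := by exact_mod_cast hjn
  have e := binomProb_succ n j hjn x
  have hpos : 0 < (n - j) * x := mul_pos (by linarith) h₀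
  refine le_of_mul_le_mul_right (e.symm.le.trans ?_) hpos
  refine mul_le_mul_of_nonneg_left ?_ (binomProb_nonneg h₀.le h₁.le _ _)
  linarith

lemma binomProb_succ_le {n j : ℕ} {x : ℝ} (h₀ : 0 < x) (h₁ : x < 1)
    (h : (n + 1) * x ≤ j + 1) : binomProb n (j + 1) x ≤ binomProb n j x := by
  rcases lt_or_ge j n with hjn | hjn
  · have e := binomProb_succ n j hjn x
    have hpos : 0 < (j + 1) * (1 - x) := mul_pos (by positivity) (by linarith)
    refine le_of_mul_le_mul_right (e.le.trans ?_) hpos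
    refine mul_le_mul_of_nonneg_left ?_ (binomProb_nonneg h₀.le h₁.le _ _)
    linarith
  · rw [binomProb_of_lt (by omega)]
    exact binomProb_nonneg h₀.le h₁.le _ _

/-- The mode of the binomial distribution. -/
lemma binomProb_le_mode {n : ℕ} {x : ℝ} (h₀ : 0 < x) (h₁ : x < 1) (i : ℕ) :
    binomProb n i x ≤ binomProb n ⌊(n + 1) * x⌋₊ x := by
  have hx : 0 ≤ (n + 1) * x := by positivity
  rcases le_total i ⌊(n + 1) * x⌋₊ with hi | hi
  · induction hi using Nat.decreasingInduction with
    | self => exact le_rfl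
    | of_succ k hk ih =>
      refine (binomProb_le_succ h₀ h₁ ?_).trans ih
      have := (Nat.le_floor_iff hx).1 (Nat.succ_le_of_lt hk)
      exact_mod_cast this
  · induction i, hi using Nat.le_induction with
    | base => exact le_rfl
    | succ k hk ih =>
      refine (binomProb_succ_le h₀ h₁ ?_).trans ih
      have := (Nat.lt_floor_add_one ((n + 1) * x)).le
      have hk' : (⌊(n + 1) * x⌋₊ : ℝ) ≤ k := by exact_mod_cast hk
      linarith

lemma card_near_le (n : ℕ) {y R : ℝ} (hR : 0 ≤ R) :
    (((Finset.range n).filter fun j : ℕ => |y - j| < R).card : ℝ) ≤ 2 * R + 1 := by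
  rcases Finset.eq_empty_or_nonempty ((Finset.range n).filter fun j : ℕ => |y - j| < R)
    with he | hne
  · rw [he]; simp; linarith
  · set s := (Finset.range n).filter fun j : ℕ => |y - j| < R
    have hsub : s ⊆ Finset.Icc (s.min' hne) (s.max' hne) := fun j hj =>
      Finset.mem_Icc.2 ⟨s.min'_le j hj, s.le_max' j hj⟩
    have hle : s.min' hne ≤ s.max' hne := s.min'_le _ (s.max'_mem hne)
    have h1 := Finset.card_le_card hsub
    rw [Nat.card_Icc] at h1
    have h2 := (abs_lt.1 (Finset.mem_filter.1 (s.min'_mem hne)).2)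
    have h3 := (abs_lt.1 (Finset.mem_filter.1 (s.max'_mem hne)).2)
    have h4 : (s.card : ℝ) ≤ s.max' hne + 1 - s.min' hne := by
      have : (s.card : ℝ) ≤ ((s.max' hne + 1 - s.min' hne : ℕ) : ℝ) := by exact_mod_cast h1
      rwa [Nat.cast_sub (by omega), Nat.cast_add, Nat.cast_one] at this
    linarith [h2.1, h2.2, h3.1, h3.2]

/-- By Chebyshev, mass at least 3/4 lies within √n of the mean, on at most 2√n + 1 ≤ 3√n integers,
none of them likelier than the mode. -/
lemma binomProb_mode_ge {n : ℕ} (hn : 1 ≤ n) {x : ℝ} (h₀ : 0 < x) (h₁ : x < 1) :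
    1 / (4 * Real.sqrt n) ≤ binomProb n ⌊(n + 1) * x⌋₊ x := by
  set R := Real.sqrt n with hR
  have hn' : (1 : ℝ) ≤ n := by exact_mod_cast hn
  have hR1 : 1 ≤ R := Real.one_le_sqrt.2 hn'
  have hR2 : R ^ 2 = n := Real.sq_sqrt (by linarith)
  have h1 := sum_binomProb n x
  rw [← Finset.sum_filter_add_sum_filter_not _ fun j : ℕ => |n * x - j| < R] at h1
  have h2 := sum_binomProb_far_le (n := n) h₀.le h₁.le (by linarith : 0 < R)
    (Finset.filter_subset (fun j : ℕ => ¬ |n * x - j| < R) (Finset.range (n + 1)))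
    (fun j hj => not_lt.1 (Finset.mem_filter.1 hj).2)
  rw [hR2] at h2
  have h3 : (n : ℝ) / (4 * n) = 1 / 4 := by field_simp
  have h4 := Finset.sum_le_card_nsmul
    ((Finset.range (n + 1)).filter fun j : ℕ => |n * x - j| < R) (fun j => binomProb n j x) _
    fun j _ => binomProb_le_mode h₀ h₁ j
  rw [nsmul_eq_mul] at h4
  have h5 := card_near_le (n + 1) (y := n * x) (by linarith : 0 ≤ R)
  have h6 : 0 ≤ binomProb n ⌊(n + 1) * x⌋₊ x := binomProb_nonneg h₀.le h₁.le _ _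
  have h7 := h4.trans (mul_le_mul_of_nonneg_right h5 h6)
  rw [div_le_iff₀ (by positivity)]
  nlinarith

/-- Chernoff's bound for a single binomial probability in the lower tail. -/
lemma binomProb_le_exp {n j : ℕ} {x ε : ℝ} (h₀ : 0 ≤ x) (h₁ : x ≤ 1) (hε : 0 ≤ ε) (hε' : ε ≤ 1)
    (hj : (j : ℝ) ≤ (x - ε) * n) : binomProb n j x ≤ Real.exp (-(n * ε ^ 2 / 4)) := by
  rcases lt_or_ge n j with hlt | hle
  · rw [binomProb_of_lt hlt]
    positivity
  have hx : 0 ≤ 1 - x := by linarith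
  -- One term of the moment generating function at -ε / 2 is bounded by the whole sum.
  have h1 : binomProb n j x * Real.exp (-(ε / 2) * j)
      ≤ (x * Real.exp (-(ε / 2)) + (1 - x)) ^ n := by
    rw [add_pow]
    refine le_trans (le_of_eq ?_) (Finset.single_le_sum (f := fun i =>
      (x * Real.exp (-(ε / 2))) ^ i * (1 - x) ^ (n - i) * (n.choose i : ℝ))
      (fun i _ => by positivity) (Finset.mem_range.2 (Nat.lt_succ_of_le hle)))
    rw [binomProb, mul_pow, ← Real.exp_nat_mul, mul_comm (-(ε / 2)) (j : ℝ)]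
    ring
  have h2 : x * Real.exp (-(ε / 2)) + (1 - x) ≤ Real.exp (-(x * (ε / 2)) + (ε / 2) ^ 2) := by
    have h3 := PAModel.exp_le_one_add_add_sq (x := -(ε / 2)) (by
      rw [abs_neg, abs_of_nonneg (by linarith)]; linarith)
    have h4 := Real.add_one_le_exp (-(x * (ε / 2)) + (ε / 2) ^ 2)
    nlinarith [mul_le_mul_of_nonneg_left h3 h₀, mul_le_mul_of_nonneg_right h₁ (sq_nonneg (ε / 2))]
  have h3 : (x * Real.exp (-(ε / 2)) + (1 - x)) ^ n
      ≤ Real.exp (n * (-(x * (ε / 2)) + (ε / 2) ^ 2)) := by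
    rw [Real.exp_nat_mul]
    exact pow_le_pow_left₀ (by positivity) h2 n
  have h4 := h1.trans h3
  rw [← le_div_iff₀ (Real.exp_pos _), ← Real.exp_sub] at h4
  refine h4.trans (Real.exp_le_exp.2 ?_)
  nlinarith [mul_le_mul_of_nonneg_left hj (by linarith : 0 ≤ ε / 2)]

/-- Just below the mode, the binomial probabilities decay at most geometrically. -/
lemma binomProb_ge_of_le_mode {n j : ℕ} {x y : ℝ} (h₀ : 0 < x) (h₁ : x < 1) (hy : y ≤ 1)
    (hjy : (n + 1) * x - j ≤ y * (x * (1 - x) * (n + 1))) {i : ℕ}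
    (hij : j ≤ i) (hi : (i : ℝ) ≤ (n + 1) * x) :
    (1 - y) ^ (i - j) * binomProb n i x ≤ binomProb n j x := by
  induction i, hij using Nat.le_induction with
  | base => simp
  | succ l hl ih =>
    push_cast at hi
    have ih' := ih (by linarith)
    refine le_trans ?_ ih'
    rw [Nat.succ_sub hl, pow_succ, mul_assoc]
    refine mul_le_mul_of_nonneg_left ?_ (pow_nonneg (by linarith) _)
    have hln : l < n := by
      have : (l + 1 : ℝ) < n + 1 := hi.trans_lt (mul_lt_of_lt_one_right (by positivity) h₁)
      exact_mod_cast (by linarith : (l : ℝ) < n)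
    have hln' : (l : ℝ) < n := by exact_mod_cast hln
    have e := binomProb_succ n l hln x
    have hpos : 0 < (n - l) * x := mul_pos (by linarith) h₀
    refine le_of_mul_le_mul_right ?_ hpos
    rw [← e, mul_comm (1 - y), mul_assoc]
    refine mul_le_mul_of_nonneg_left ?_ (binomProb_nonneg h₀.le h₁.le _ _)
    have hjl : (j : ℝ) ≤ l := by exact_mod_cast hl
    have hy0 : 0 ≤ y := by
      by_contra hneg
      have : 0 < x * (1 - x) * (n + 1) := by
        have : 0 < 1 - x := by linarith
        positivity
      nlinarith
    -- The consecutive ratio is 1 - ((n + 1) x - (l + 1)) / ((n - l) x). Its denominator is bounded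
    -- below because l + 1 ≤ (n + 1) x.
    have h3 : x * (1 - x) * (n + 1) ≤ (n - l) * x := by
      have : (1 - x) * (n + 1) ≤ n - l := by linarith
      nlinarith
    have := mul_le_mul_of_nonneg_left h3 hy0
    linarith

lemma exp_neg_two_mul_le {y : ℝ} (h₀ : 0 ≤ y) (h₁ : y ≤ 1 / 2) : Real.exp (-(2 * y)) ≤ 1 - y := by
  rw [Real.exp_neg, inv_le_comm₀ (Real.exp_pos _) (by linarith)]
  refine le_trans ?_ (Real.add_one_le_exp (2 * y))
  rw [inv_le_iff_one_le_mul₀ (by linarith)]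
  nlinarith

/-- A binomial probability of order `1 / n` below the mode is attained only at a distance
of order `√(n log n)` from the mean. -/
lemma log_le_of_binomProb_le {n j : ℕ} (hn : 1 ≤ n) {x τ : ℝ} (h₀ : 0 < x) (h₁ : x < 1)
    (hτ : 0 < τ) (hj : (j : ℝ) ≤ (n + 1) * x)
    (hm : (n + 1) * x - j ≤ x * (1 - x) / 2 * (n + 1)) (hb : (n + 1) * binomProb n j x ≤ τ) :
    Real.log (n + 1) / 2 - Real.log (4 * τ)
      ≤ 2 * ((n + 1) * x - j) ^ 2 / (x * (1 - x) * (n + 1)) := by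
  have hx : 0 < 1 - x := by linarith
  set m := (n + 1) * x - j with hmdef
  have hm0 : 0 ≤ m := by linarith
  set y := m / (x * (1 - x) * (n + 1)) with hy
  have hy0 : 0 ≤ y := by positivity
  have hy1 : y ≤ 1 / 2 := by
    rw [hy, div_le_iff₀ (by positivity)]
    linarith
  have hx' : 0 ≤ (n + 1) * x := by positivity
  have hJ : j ≤ ⌊(n + 1) * x⌋₊ := (Nat.le_floor_iff hx').2 hj
  have hJ' := Nat.floor_le hx'
  have h1 := binomProb_ge_of_le_mode (n := n) (j := j) (y := y) h₀ h₁ (by linarith)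
    (by rw [hy]; field_simp; exact le_rfl) hJ hJ'
  have h2 := binomProb_mode_ge hn h₀ h₁
  -- The mode is at most m steps above j, each costing a factor of at least 1 - y ≥ exp (-2 y).
  have h3 : Real.exp (-(2 * y * m)) ≤ (1 - y) ^ (⌊(n + 1) * x⌋₊ - j) := by
    refine le_trans ?_ (pow_le_pow_left₀ (Real.exp_pos _).le (exp_neg_two_mul_le hy0 hy1) _)
    rw [← Real.exp_nat_mul]
    refine Real.exp_le_exp.2 ?_
    rw [Nat.cast_sub hJ]
    nlinarith
  have hn' : (1 : ℝ) ≤ n := by exact_mod_cast hn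
  have hs0 : 0 < Real.sqrt n := Real.sqrt_pos.2 (by linarith)
  have h4 : Real.sqrt (n + 1) / 4 ≤ (n + 1) * (1 / (4 * Real.sqrt n)) := by
    rw [mul_one_div, div_le_div_iff₀ (by norm_num) (by positivity)]
    have : Real.sqrt n ≤ Real.sqrt (n + 1) := Real.sqrt_le_sqrt (by linarith)
    have h5 : Real.sqrt (n + 1) ^ 2 = n + 1 := Real.sq_sqrt (by linarith)
    nlinarith
  have h5 : Real.exp (-(2 * y * m)) * (Real.sqrt (n + 1) / 4) ≤ τ := by
    calc _ ≤ (1 - y) ^ (⌊(n + 1) * x⌋₊ - j) *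
          ((n + 1) * binomProb n ⌊(n + 1) * x⌋₊ x) := by
          refine mul_le_mul h3 (h4.trans ?_) (by positivity) (pow_nonneg (by linarith) _)
          exact mul_le_mul_of_nonneg_left h2 (by positivity)
      _ = (n + 1) * ((1 - y) ^ (⌊(n + 1) * x⌋₊ - j) * binomProb n ⌊(n + 1) * x⌋₊ x) := by ring
      _ ≤ (n + 1) * binomProb n j x := by gcongr
      _ ≤ τ := hb
  have h6 : Real.sqrt (n + 1) ≤ 4 * τ * Real.exp (2 * y * m) := by
    rw [Real.exp_neg, inv_mul_le_iff₀ (Real.exp_pos _)] at h5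
    linarith
  have h7 := Real.log_le_log (by positivity) h6
  rw [Real.log_sqrt (by positivity), Real.log_mul (by positivity) (by positivity),
    Real.log_exp] at h7
  have e : 2 * m ^ 2 / (x * (1 - x) * (n + 1)) = 2 * y * m := by rw [hy]; ring
  rw [e]
  linarith

/-- A threshold below the mean at which the binomial probability, multiplied by the number of
trials, falls into a prescribed window. -/
lemma exists_threshold {x τ₁ τ₂ ε : ℝ} (h₀ : 0 < x) (h₁ : x < 1) (hτ₁ : 0 < τ₁) (hτ : τ₁ < τ₂)
    (hε : 0 < ε) : ∃ κ > 0, ∀ᶠ n : ℕ in atTop, ∃ j : ℕ, 1 ≤ j ∧ j < n ∧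
      τ₁ ≤ (n + 1) * binomProb n j x ∧ (n + 1) * binomProb n j x ≤ τ₂ ∧
      (n + 1) * x - j ≤ ε * (n + 1) ∧
      κ * Real.sqrt ((n + 1) * Real.log (n + 1)) ≤ (n + 1) * x - j := by
  have hx : 0 < 1 - x := by linarith
  have hv : 0 < x * (1 - x) := mul_pos h₀ hx
  -- δ bounds the relative distance of j below the mean. The second entry serves
  -- `log_le_of_binomProb_le`; the third keeps the ratio of the probabilities at j and j - 1 below
  -- τ₂ / τ₁.
  set δ := min (min ε (x * (1 - x) / 2)) (x * (1 - x) * (τ₂ - τ₁) / (τ₁ + τ₂)) with hδ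
  have hτ₂ : 0 < τ₂ := hτ₁.trans hτ
  have hδ0 : 0 < δ := lt_min (lt_min hε (by positivity))
    (div_pos (mul_pos hv (by linarith)) (by positivity))
  have hδε : δ ≤ ε := (min_le_left _ _).trans (min_le_left _ _)
  have hδv : δ ≤ x * (1 - x) / 2 := (min_le_left _ _).trans (min_le_right _ _)
  have hδτ : δ * (τ₁ + τ₂) ≤ x * (1 - x) * (τ₂ - τ₁) := by
    rw [← le_div_iff₀ (by positivity)]
    exact min_le_right _ _
  have hδx : δ < x := by nlinarith
  refine ⟨Real.sqrt (x * (1 - x) / 8), Real.sqrt_pos.2 (by positivity), ?_⟩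
  have ht : Tendsto (fun n : ℕ => (n : ℝ)) atTop atTop := tendsto_natCast_atTop_atTop
  have hexp : ∀ᶠ n : ℕ in atTop, ((n : ℝ) + 1) * Real.exp (-(n * (δ / 2) ^ 2 / 4)) < τ₁ := by
    set a := (δ / 2) ^ 2 / 4 with ha
    have ha0 : 0 < a := by positivity
    have h1 := (Real.tendsto_pow_mul_exp_neg_atTop_nhds_zero 1).comp
      (ht.const_mul_atTop ha0)
    have h2 := (Real.tendsto_pow_mul_exp_neg_atTop_nhds_zero 0).comp
      (ht.const_mul_atTop ha0)
    have h3 := (h1.const_mul (1 / a)).add h2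
    rw [mul_zero, add_zero] at h3
    filter_upwards [h3.eventually_lt_const hτ₁] with n hn
    refine lt_of_le_of_lt (le_of_eq ?_) hn
    simp only [Function.comp, pow_one, pow_zero]
    have : (n : ℝ) * (δ / 2) ^ 2 / 4 = a * n := by rw [ha]; ring
    rw [this]
    field_simp
  have hlog : Tendsto (fun n : ℕ => Real.log ((n : ℝ) + 1)) atTop atTop :=
    Real.tendsto_log_atTop.comp (tendsto_atTop_add_const_right _ _ ht)
  have hsqrt : Tendsto (fun n : ℕ => Real.sqrt (n : ℝ)) atTop atTop :=
    Real.tendsto_sqrt_atTop.comp ht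
  filter_upwards [hexp, hlog.eventually_ge_atTop (4 * Real.log (4 * τ₂)),
    hsqrt.eventually_ge_atTop (4 * τ₁), ht.eventually_ge_atTop (2 * x / δ),
    ht.eventually_ge_atTop (2 / (1 - x)), eventually_ge_atTop 1] with n hexp hlog hsq hn1 hn2 hn3
  have hn3' : (1 : ℝ) ≤ n := by exact_mod_cast hn3
  have hx' : 0 ≤ ((n : ℝ) + 1) * x := by positivity
  have hex : ∃ j : ℕ, τ₁ ≤ (n + 1) * binomProb n j x := by
    refine ⟨⌊(n + 1) * x⌋₊, ?_⟩
    have h1 := binomProb_mode_ge hn3 h₀ h₁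
    have hs0 : 0 < Real.sqrt n := Real.sqrt_pos.2 (by linarith)
    have h2 : Real.sqrt n / 4 ≤ (n + 1) * (1 / (4 * Real.sqrt n)) := by
      rw [mul_one_div, div_le_div_iff₀ (by norm_num) (by positivity)]
      have h5 : Real.sqrt n ^ 2 = n := Real.sq_sqrt (by linarith)
      nlinarith
    have h3 := mul_le_mul_of_nonneg_left h1 (by positivity : (0 : ℝ) ≤ (n : ℝ) + 1)
    linarith
  classical
  -- The threshold is the first index at which the scaled probability reaches τ₁; the mode shows
  -- that there is one.
  have hspec := Nat.find_spec hex
  have hmin : ∀ i, i < Nat.find hex → (n + 1) * binomProb n i x < τ₁ := fun i hi =>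
    not_le.1 (Nat.find_min hex hi)
  have hle : Nat.find hex ≤ ⌊(n + 1) * x⌋₊ := by
    refine Nat.find_min' hex (hspec.trans ?_)
    exact mul_le_mul_of_nonneg_left (binomProb_le_mode h₀ h₁ _) (by positivity)
  generalize Nat.find hex = j at hspec hmin hle
  have hjx : (j : ℝ) ≤ (n + 1) * x := (Nat.le_floor_iff hx').1 hle
  have hlow : (x - δ) * (n + 1) < j := by
    -- Further below, Chernoff's bound is exponentially small, hence under τ₁. Using δ / 2 absorbs
    -- the change from n + 1 to n.
    by_contra hcon
    rw [not_lt] at hcon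
    rw [div_le_iff₀ hδ0] at hn1
    have h1 : (j : ℝ) ≤ (x - δ / 2) * n := by nlinarith
    have h2 := binomProb_le_exp (n := n) (j := j) h₀.le h₁.le (by positivity : 0 ≤ δ / 2)
      (by nlinarith) h1
    have h3 := mul_le_mul_of_nonneg_left h2 (by positivity : (0 : ℝ) ≤ (n : ℝ) + 1)
    linarith
  have hj1 : 1 ≤ j := by
    have : (0 : ℝ) < j := lt_of_le_of_lt (mul_nonneg (by linarith) (by positivity)) hlow
    exact_mod_cast this
  have hjn : j < n := by
    rw [div_le_iff₀ hx] at hn2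
    have : (j : ℝ) < n := by nlinarith
    exact_mod_cast this
  have hupper : (n + 1) * binomProb n j x ≤ τ₂ := by
    -- At j - 1 the value is still below τ₁, and one step cannot carry it beyond τ₂.
    obtain ⟨i, rfl⟩ : ∃ i, j = i + 1 := ⟨j - 1, by omega⟩
    have h1 := hmin i (Nat.lt_succ_self i)
    have e := binomProb_succ n i (by omega) x
    push_cast at hlow hjx
    have hpos : 0 < ((i : ℝ) + 1) * (1 - x) := by positivity
    have h2 : τ₁ * ((n - i) * x) ≤ τ₂ * ((i + 1) * (1 - x)) := by
      have h3 : (n : ℝ) - i ≤ (1 - x + δ) * (n + 1) := by linarith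
      have h4 : τ₁ * ((n - i) * x) ≤ τ₁ * ((1 - x + δ) * (n + 1) * x) := by gcongr
      have h5 : τ₂ * ((x - δ) * (n + 1) * (1 - x)) ≤ τ₂ * ((i + 1) * (1 - x)) := by gcongr
      have h6 : τ₁ * ((1 - x + δ) * x) ≤ τ₂ * ((x - δ) * (1 - x)) := by
        nlinarith [mul_pos hδ0 hτ₁, mul_pos hδ0 hτ₂, mul_pos (mul_pos hδ0 hτ₁) hx,
          mul_pos (mul_pos hδ0 hτ₂) h₀]
      have h7 := mul_le_mul_of_nonneg_right h6 (by positivity : (0 : ℝ) ≤ (n : ℝ) + 1)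
      linarith
    have hni : (0 : ℝ) ≤ n - i := by
      have : (i : ℝ) + 1 ≤ n := by exact_mod_cast hjn.le
      linarith
    refine le_of_mul_le_mul_right ?_ hpos
    calc _ = (n + 1) * binomProb n i x * ((n - i) * x) := by rw [mul_assoc, e, mul_assoc]
      _ ≤ τ₁ * ((n - i) * x) := mul_le_mul_of_nonneg_right h1.le (mul_nonneg hni h₀.le)
      _ ≤ _ := h2
  have hmδ : (n + 1) * x - j ≤ δ * (n + 1) := by linarith
  refine ⟨j, hj1, hjn, hspec, hupper, hmδ.trans (by gcongr), ?_⟩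
  have h1 := log_le_of_binomProb_le hn3 h₀ h₁ hτ₂ hjx (hmδ.trans (by gcongr)) hupper
  have hm0 : 0 ≤ (n + 1) * x - j := by linarith
  rw [← Real.sqrt_mul (by positivity)]
  refine Real.sqrt_le_iff.2 ⟨hm0, ?_⟩
  have h2 : Real.log (n + 1) / 4
      ≤ 2 * ((n + 1) * x - j) ^ 2 / (x * (1 - x) * (n + 1)) := by linarith
  rw [le_div_iff₀ (by positivity)] at h2
  linarith

/-- The lower tail of a binomial distribution is dominated by a geometric series. -/
lemma sum_binomProb_lower_le {n j : ℕ} {x τ : ℝ} (h₀ : 0 < x) (h₁ : x < 1)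
    (hj : (j : ℝ) < (n + 1) * x) (hb : (n + 1) * binomProb n j x ≤ τ) :
    ∑ i ∈ Finset.range (j + 1), binomProb (n + 1) i x ≤ 2 * τ / ((n + 1) * x - j) := by
  have hx : 0 < 1 - x := by linarith
  set m := (n + 1) * x - j with hm
  have hm0 : 0 < m := by linarith
  set s := m / (2 * (n + 1)) with hs
  have hs0 : 0 < s := by positivity
  have hsm : s * (2 * (n + 1)) = m := by rw [hs]; field_simp
  have hs1 : s ≤ 1 := by
    rw [hs, div_le_one (by positivity)]
    nlinarith
  have hnn : ∀ i, 0 ≤ binomProb (n + 1) i x := fun i => binomProb_nonneg h₀.le h₁.le _ _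
  have hjn : j ≤ n := by
    have : (j : ℝ) < n + 1 := hj.trans (mul_lt_of_lt_one_right (by positivity) h₁)
    exact Nat.lt_succ_iff.1 (by exact_mod_cast this)
  -- Below the mean each term is at most 1 - s times the next, so a partial sum is at most its last
  -- term divided by s.
  have key : ∀ i ≤ j, s * ∑ l ∈ Finset.range (i + 1), binomProb (n + 1) l x
      ≤ binomProb (n + 1) i x := by
    intro i
    induction i with
    | zero =>
      intro _
      simpa using mul_le_of_le_one_left (hnn 0) hs1
    | succ l ih =>
      intro hl
      have ih' := ih (by omega)
      rw [Finset.sum_range_succ, mul_add]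
      have hstep : binomProb (n + 1) l x ≤ (1 - s) * binomProb (n + 1) (l + 1) x := by
        have e := binomProb_succ (n + 1) l (by omega) x
        push_cast at e
        have hlj : (l : ℝ) + 1 ≤ j := by exact_mod_cast hl
        have hln : (j : ℝ) ≤ n := by exact_mod_cast hjn
        have hpos : 0 < ((n : ℝ) + 1 - l) * x := mul_pos (by linarith) h₀
        refine le_of_mul_le_mul_right ?_ hpos
        rw [← e, mul_comm (1 - s), mul_assoc]
        refine mul_le_mul_of_nonneg_left ?_ (hnn _)
        have h1 : s * ((n + 1 - l) * x) ≤ s * (2 * (n + 1)) := by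
          refine mul_le_mul_of_nonneg_left ?_ hs0.le
          nlinarith [Nat.cast_nonneg (α := ℝ) l]
        linarith
      linarith
  have h1 := key j le_rfl
  have h2 : binomProb (n + 1) j x ≤ binomProb n j x := by
    have hc := Nat.choose_mul_succ_eq n j
    have hc' : (n.choose j : ℝ) * (n + 1) = (n + 1).choose j * (n + 1 - j) := by
      have := congrArg (Nat.cast : ℕ → ℝ) hc
      push_cast [Nat.cast_sub (show j ≤ n + 1 by omega)] at this
      exact this
    have e : binomProb (n + 1) j x * (n + 1 - j) = binomProb n j x * ((n + 1) * (1 - x)) := by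
      unfold binomProb
      rw [show n + 1 - j = (n - j) + 1 by omega, pow_succ]
      linear_combination -(x ^ j * (1 - x) ^ (n - j) * (1 - x)) * hc'
    have hpos : 0 < ((n : ℝ) + 1) * (1 - x) := by positivity
    refine le_of_mul_le_mul_right (le_trans ?_ e.le) hpos
    exact mul_le_mul_of_nonneg_left (by linarith) (hnn j)
  rw [le_div_iff₀ hm0]
  have h3 : (0 : ℝ) < 2 * (n + 1) := by positivity
  have h4 := mul_le_mul_of_nonneg_right (h1.trans h2) h3.le
  calc _ = s * (∑ i ∈ Finset.range (j + 1), binomProb (n + 1) i x) * (2 * (n + 1)) := by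
        rw [← hsm]; ring
    _ ≤ _ := h4
    _ ≤ _ := by linarith

/-! ### The passing probability of a threshold test -/

/-- The probability of more than `j` successes in `n + 1` trials. -/
def exceedProb (n j : ℕ) (x : ℝ) : ℝ :=
  1 - ∑ i ∈ Finset.range (j + 1), binomProb (n + 1) i x

lemma exceedProb_eq_sum {n j : ℕ} (hj : j ≤ n) (x : ℝ) :
    exceedProb n j x = ∑ i ∈ Finset.Ico (j + 1) (n + 2), binomProb (n + 1) i x := by
  rw [exceedProb, ← sum_binomProb (n + 1) x,
    ← Finset.sum_range_add_sum_Ico _ (show j + 1 ≤ n + 1 + 1 by omega)]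
  ring

lemma exceedProb_le_one {x : ℝ} (h₀ : 0 ≤ x) (h₁ : x ≤ 1) (n j : ℕ) : exceedProb n j x ≤ 1 :=
  sub_le_self _ (Finset.sum_nonneg fun _ _ => binomProb_nonneg h₀ h₁ _ _)

/-- The derivatives of the Bernstein polynomials telescope. With n + 1 trials in the test, the slope
is a binomial probability for n trials. -/
lemma hasDerivAt_exceedProb (n j : ℕ) (x : ℝ) :
    HasDerivAt (exceedProb n j) ((n + 1) * binomProb n j x) x := by
  have hd : ∀ j : ℕ, HasDerivAt (fun x => ∑ i ∈ Finset.range (j + 1), binomProb (n + 1) i x)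
      (-((n + 1) * binomProb n j x)) x := by
    intro j
    induction j with
    | zero =>
      have := (bernsteinPolynomial ℝ (n + 1) 0).hasDerivAt x
      rw [bernsteinPolynomial.derivative_zero] at this
      simp only [eval_bernsteinPolynomial, Polynomial.eval_mul, Polynomial.eval_neg,
        Polynomial.eval_natCast, Nat.add_sub_cancel] at this
      simp only [zero_add, Finset.sum_range_one]
      refine this.congr_deriv ?_
      push_cast
      ring
    | succ l ih =>
      have := (bernsteinPolynomial ℝ (n + 1) (l + 1)).hasDerivAt x
      rw [bernsteinPolynomial.derivative_succ] at this
      simp only [eval_bernsteinPolynomial, Polynomial.eval_mul, Polynomial.eval_sub,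
        Polynomial.eval_natCast, Nat.add_sub_cancel] at this
      simp only [Finset.sum_range_succ _ (l + 1)]
      refine (ih.add this).congr_deriv ?_
      push_cast
      ring
  exact ((hd j).const_sub 1).congr_deriv (neg_neg _)

lemma monotoneOn_exceedProb (n j : ℕ) : MonotoneOn (exceedProb n j) (Icc 0 1) := by
  refine monotoneOn_of_deriv_nonneg (convex_Icc _ _)
    (fun x _ => (hasDerivAt_exceedProb n j x).continuousAt.continuousWithinAt)
    (fun x _ => (hasDerivAt_exceedProb n j x).differentiableAt.differentiableWithinAt) ?_
  rw [interior_Icc]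
  intro x hx
  rw [(hasDerivAt_exceedProb n j x).deriv]
  have := binomProb_nonneg hx.1.le hx.2.le n j
  positivity

lemma hasDerivAt_binomProb {n j : ℕ} (hj : 1 ≤ j) (hjn : j < n) (x : ℝ) :
    HasDerivAt (binomProb n j)
      (n.choose j * x ^ (j - 1) * (1 - x) ^ (n - j - 1) * (j - n * x)) x := by
  have h1 := ((hasDerivAt_pow j x).const_mul (n.choose j : ℝ)).mul
    (((hasDerivAt_id x).const_sub 1).pow (n - j))
  refine h1.congr_deriv ?_
  obtain ⟨i, rfl⟩ : ∃ i, j = i + 1 := ⟨j - 1, by omega⟩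
  obtain ⟨k, rfl⟩ : ∃ k, n = i + 1 + (k + 1) := ⟨n - (i + 1) - 1, by omega⟩
  simp only [id, Nat.add_sub_cancel, Nat.add_sub_cancel_left, Pi.pow_apply]
  push_cast
  ring

/-- The derivative is a multiple of `binomProb n j`, which increases up to j / n and decreases
afterwards, so j / n is the inflection point. -/
lemma convexOn_exceedProb {n j : ℕ} (hj : 1 ≤ j) (hjn : j < n) :
    ConvexOn ℝ (Icc 0 (j / n : ℝ)) (exceedProb n j) := by
  have hn : (0 : ℝ) < n := by exact_mod_cast (by omega : 0 < n)
  have hjn' : (j : ℝ) ≤ n := by exact_mod_cast hjn.le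
  have hderiv : deriv (exceedProb n j) = fun x => ((n : ℝ) + 1) * binomProb n j x :=
    funext fun x => (hasDerivAt_exceedProb n j x).deriv
  refine MonotoneOn.convexOn_of_deriv (convex_Icc _ _)
    (fun x _ => (hasDerivAt_exceedProb n j x).continuousAt.continuousWithinAt)
    (fun x _ => (hasDerivAt_exceedProb n j x).differentiableAt.differentiableWithinAt) ?_
  rw [hderiv]
  suffices hm : MonotoneOn (binomProb n j) (interior (Icc 0 (j / n : ℝ))) from
    fun x hx y hy hxy => mul_le_mul_of_nonneg_left (hm hx hy hxy) (by positivity)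
  refine monotoneOn_of_deriv_nonneg (by rw [interior_Icc]; exact convex_Ioo _ _)
    (fun x _ => (hasDerivAt_binomProb hj hjn x).continuousAt.continuousWithinAt)
    (fun x _ => (hasDerivAt_binomProb hj hjn x).differentiableAt.differentiableWithinAt) ?_
  rw [interior_interior, interior_Icc]
  rintro x ⟨hx0, hx1⟩
  rw [(hasDerivAt_binomProb hj hjn x).deriv]
  have h1 : (j : ℝ) / n ≤ 1 := (div_le_one hn).2 hjn'
  have h2 : 0 ≤ 1 - x := by linarith
  have h3 : 0 ≤ j - n * x := by
    rw [lt_div_iff₀ hn] at hx1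
    linarith
  positivity

lemma concaveOn_exceedProb {n j : ℕ} (hj : 1 ≤ j) (hjn : j < n) :
    ConcaveOn ℝ (Icc (j / n : ℝ) 1) (exceedProb n j) := by
  have hn : (0 : ℝ) < n := by exact_mod_cast (by omega : 0 < n)
  have hderiv : deriv (exceedProb n j) = fun x => ((n : ℝ) + 1) * binomProb n j x :=
    funext fun x => (hasDerivAt_exceedProb n j x).deriv
  refine AntitoneOn.concaveOn_of_deriv (convex_Icc _ _)
    (fun x _ => (hasDerivAt_exceedProb n j x).continuousAt.continuousWithinAt)
    (fun x _ => (hasDerivAt_exceedProb n j x).differentiableAt.differentiableWithinAt) ?_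
  rw [hderiv]
  suffices hm : AntitoneOn (binomProb n j) (interior (Icc (j / n : ℝ) 1)) from
    fun x hx y hy hxy => mul_le_mul_of_nonneg_left (hm hx hy hxy) (by positivity)
  refine antitoneOn_of_deriv_nonpos (by rw [interior_Icc]; exact convex_Ioo _ _)
    (fun x _ => (hasDerivAt_binomProb hj hjn x).continuousAt.continuousWithinAt)
    (fun x _ => (hasDerivAt_binomProb hj hjn x).differentiableAt.differentiableWithinAt) ?_
  rw [interior_interior, interior_Icc]
  rintro x ⟨hx0, hx1⟩
  rw [(hasDerivAt_binomProb hj hjn x).deriv]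
  have h1 : 0 ≤ x := le_trans (by positivity) hx0.le
  have h2 : 0 ≤ 1 - x := by linarith
  have h3 : j - n * x ≤ 0 := by
    rw [div_lt_iff₀ hn] at hx0
    linarith
  exact mul_nonpos_of_nonneg_of_nonpos (by positivity) h3

lemma exceedProb_le_of_far {n j : ℕ} (hj : j ≤ n) {x R : ℝ} (h₀ : 0 ≤ x) (h₁ : x ≤ 1)
    (hR : 0 < R) (hfar : (n + 1) * x + R ≤ j) : exceedProb n j x ≤ (n + 1) / (4 * R ^ 2) := by
  rw [exceedProb_eq_sum hj]
  have := sum_binomProb_far_le (n := n + 1) h₀ h₁ hR (s := Finset.Ico (j + 1) (n + 2))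
    (fun i hi => Finset.mem_range.2 (Finset.mem_Ico.1 hi).2) fun i hi => by
      have hi' : (j : ℝ) + 1 ≤ i := by exact_mod_cast (Finset.mem_Ico.1 hi).1
      push_cast
      rw [abs_sub_comm]
      refine le_trans ?_ (le_abs_self _)
      linarith
  push_cast at this
  exact this

namespace PAModel

/-- The test that passes when more than `j` samples pass. -/
def thresholdTest (n j : ℕ) (a : Outcome n) : Bool :=
  decide (j < (Finset.univ.filter fun i => a i = true).card)

lemma expect_card (M : PAModel) {n : ℕ} (η : ℝ) (f : ℕ → ℝ) :
    (M.expect η fun a : Outcome n => f (Finset.univ.filter fun i => a i = true).card)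
      = ∑ i ∈ Finset.range (n + 1), binomProb n i (M.passProb η) * f i := by
  set p := M.passProb η with hp
  have h1 := Finset.sum_powerset_apply_card
    (fun i => p ^ i * (1 - p) ^ (n - i) * f i) (x := (Finset.univ : Finset (Fin n)))
  rw [Finset.card_univ, Fintype.card_fin] at h1
  have h2 : ∑ i ∈ Finset.range (n + 1), binomProb n i p * f i
      = ∑ i ∈ Finset.range (n + 1), n.choose i • (p ^ i * (1 - p) ^ (n - i) * f i) := by
    refine Finset.sum_congr rfl fun i _ => ?_
    rw [nsmul_eq_mul, binomProb]
    ring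
  rw [h2, ← h1, expect]
  refine Finset.sum_nbij' (fun a => Finset.univ.filter fun i => a i = true)
    (fun s i => decide (i ∈ s)) (by simp) (by simp) (fun a _ => by ext i; simp)
    (fun s _ => by ext i; simp) fun a _ => ?_
  rw [outcomeProb, Finset.prod_ite, Finset.prod_const, Finset.prod_const]
  congr 3
  have := Finset.card_filter_add_card_filter_not (s := (Finset.univ : Finset (Fin n)))
    (fun i => a i = true)
  rw [Finset.card_univ, Fintype.card_fin] at this
  omega

lemma passTest_thresholdTest (M : PAModel) {n j : ℕ} (hj : j ≤ n) (η : ℝ) :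
    M.passTest (thresholdTest (n + 1) j) η = exceedProb n j (M.passProb η) := by
  have h := M.expect_card (n := n + 1) η fun i => if j < i then 1 else 0
  have h' : M.passTest (thresholdTest (n + 1) j) η = M.expect η fun a : Outcome (n + 1) =>
      if j < (Finset.univ.filter fun i => a i = true).card then 1 else 0 := by
    simp [passTest, thresholdTest]
  rw [h', h, exceedProb_eq_sum hj]
  simp only [mul_ite, mul_one, mul_zero]
  rw [← Finset.sum_filter]
  refine Finset.sum_congr ?_ fun _ _ => rfl
  ext i
  simp only [Finset.mem_filter, Finset.mem_range, Finset.mem_Ico]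
  omega

end PAModel

/-! ### Global incentive compatibility of threshold contracts -/

lemma ConvexOn.tangent_le {S : Set ℝ} {f : ℝ → ℝ} {f' x y : ℝ} (hf : ConvexOn ℝ S f) (hx : x ∈ S)
    (hy : y ∈ S) (hd : HasDerivAt f f' x) : f x + f' * (y - x) ≤ f y := by
  rcases lt_trichotomy x y with hlt | rfl | hlt
  · have := hf.le_slope_of_hasDerivAt hx hy hlt hd
    rw [slope_def_field, le_div_iff₀ (by linarith)] at this
    linarith
  · simp
  · have := hf.slope_le_of_hasDerivAt hy hx hlt hd
    rw [slope_def_field, div_le_iff₀ (by linarith)] at this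
    linarith

/-- Global incentive compatibility from the first-order condition, for a passing probability `Q`
that is convex up to `η₀`, concave from there on, and that rises from almost `0` at `η₁` to almost
`1` at `ηs`. -/
lemma isMaxOn_of_sigmoid {Q E : ℝ → ℝ} {η₀ η₁ ηs q Δ e θ : ℝ} (h₁ : 0 ≤ η₁) (h₁₀ : η₁ < η₀)
    (h₀ : η₀ ≤ ηs) (hs : ηs ≤ 1) (hQ₁ : ConvexOn ℝ (Icc 0 η₀) Q) (hQ₂ : ConcaveOn ℝ (Icc η₀ 1) Q)
    (hQ : MonotoneOn Q (Icc 0 1)) (hq : HasDerivAt Q q ηs)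
    (hE : ConvexOn ℝ (Icc 0 1) E) (hE' : MonotoneOn E (Icc 0 1)) (he : HasDerivAt E e ηs)
    (hΔ : 0 < Δ) (hfoc : Δ * q = e) (hθ : θ ≤ 1 / 4) (hQη₁ : Q η₁ ≤ θ) (hQηs : 1 - θ ≤ Q ηs)
    (hfar : E ηs - E 0 ≤ Δ * (1 - 2 * θ)) (hnear : 4 * (e * (ηs - η₁)) ≤ Δ) :
    ∀ η ∈ Icc (0 : ℝ) 1, Δ * Q η - E η ≤ Δ * Q ηs - E ηs := by
  have hsm : ηs ∈ Icc (0 : ℝ) 1 := ⟨by linarith, hs⟩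
  have h0m : η₀ ∈ Icc (0 : ℝ) 1 := ⟨by linarith, by linarith⟩
  have h1m : η₁ ∈ Icc (0 : ℝ) 1 := ⟨by linarith, by linarith⟩
  have hEt : ∀ η ∈ Icc (0 : ℝ) 1, E ηs + e * (η - ηs) ≤ E η := fun η hη =>
    hE.tangent_le hsm hη he
  -- On the concave part the tangents of `Q` and `E` at `ηs` suffice: by the first-order condition
  -- their slopes cancel.
  have hupper : ∀ η ∈ Icc η₀ 1, Δ * Q η - E η ≤ Δ * Q ηs - E ηs := by
    intro η hη
    have h2 := hQ₂.neg.tangent_le (x := ηs) ⟨h₀, hs⟩ hη hq.neg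
    have h3 := hEt η ⟨by linarith [hη.1], hη.2⟩
    simp only [Pi.neg_apply] at h2
    have h4 : Δ * Q η ≤ Δ * (Q ηs + q * (η - ηs)) :=
      mul_le_mul_of_nonneg_left (by linarith) hΔ.le
    have h5 : Δ * (Q ηs + q * (η - ηs)) = Δ * Q ηs + e * (η - ηs) := by rw [← hfoc]; ring
    linarith
  have he0 : 0 ≤ e := by
    have h2 := hEt η₁ h1m
    have h3 := hE' h1m hsm (by linarith)
    nlinarith
  intro η hη
  rcases le_or_gt η₀ η with hge | hlt
  · exact hupper η ⟨hge, hη.2⟩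
  rcases le_or_gt η η₁ with hle | hgt
  -- Below η₁ the bonus is almost surely lost, which outweighs all savings of effort.
  · have h2 := hQ hη h1m hle
    have h3 := hE' (a := 0) (by simp) hη hη.1
    have h4 : Δ * Q η ≤ Δ * θ := mul_le_mul_of_nonneg_left (by linarith) hΔ.le
    have h5 : Δ * (1 - θ) ≤ Δ * Q ηs := mul_le_mul_of_nonneg_left hQηs hΔ.le
    linarith
  -- If Q η ≤ 1/2, the expected bonus falls by at least Δ / 4, while the effort saved is worth at
  -- most e (ηs - η₁) ≤ Δ / 4.
  rcases le_or_gt (Q η) (1 / 2) with hQle | hQgt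
  · have h2 := hEt η hη
    have h3 : e * (ηs - η) ≤ e * (ηs - η₁) := mul_le_mul_of_nonneg_left (by linarith) he0
    have h4 : Δ * Q η ≤ Δ * (1 / 2) := mul_le_mul_of_nonneg_left hQle hΔ.le
    have h5 : Δ * (3 / 4) ≤ Δ * Q ηs := mul_le_mul_of_nonneg_left (by linarith) hΔ.le
    linarith
  -- Otherwise Q has risen by at least 1/4 since η₁, so its mean slope there is at least e / Δ. By
  -- convexity this persists up to η₀, where moving up pays and the concave case takes over.
  · refine le_trans ?_ (hupper η₀ ⟨le_rfl, h0m.2⟩)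
    have h2 := hQ₁.slope_mono_adjacent (x := η₁) (y := η) (z := η₀) ⟨h₁, h₁₀.le⟩
      ⟨by linarith, le_rfl⟩ hgt hlt
    have h3 := hE.secant_mono hη h0m hsm hlt.ne' (by linarith) h₀
    have h4 : (E ηs - E η) / (ηs - η) ≤ e := by
      rw [div_le_iff₀ (by linarith)]
      linarith [hEt η hη]
    have h5 : E η₀ - E η ≤ e * (η₀ - η) := by
      have := h3.trans h4
      rwa [div_le_iff₀ (by linarith)] at this
    have h6 : e / Δ ≤ (Q η - Q η₁) / (η - η₁) := by
      rw [div_le_div_iff₀ hΔ (by linarith)]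
      have h7 : e * (η - η₁) ≤ e * (ηs - η₁) := mul_le_mul_of_nonneg_left (by linarith) he0
      have h8 : 1 / 4 * Δ ≤ (Q η - Q η₁) * Δ := mul_le_mul_of_nonneg_right (by linarith) hΔ.le
      linarith
    have h7 := h6.trans h2
    rw [div_le_div_iff₀ hΔ (by linarith)] at h7
    linarith

namespace PAModel

lemma passProb_combo (M : PAModel) {x y a b : ℝ} (hab : a + b = 1) :
    M.passProb (a • x + b • y) = a • M.passProb x + b • M.passProb y := by
  simp only [passProb, smul_eq_mul]
  linear_combination (-1 / 2) * hab

lemma convexOn_comp_passProb (M : PAModel) {f : ℝ → ℝ} {S T : Set ℝ} (hf : ConvexOn ℝ T f)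
    (hS : Convex ℝ S) (hmap : ∀ x ∈ S, M.passProb x ∈ T) :
    ConvexOn ℝ S fun η => f (M.passProb η) := by
  refine ⟨hS, fun x hx y hy a b ha hb hab => ?_⟩
  simp only [M.passProb_combo hab]
  exact hf.2 (hmap x hx) (hmap y hy) ha hb hab

lemma concaveOn_comp_passProb (M : PAModel) {f : ℝ → ℝ} {S T : Set ℝ} (hf : ConcaveOn ℝ T f)
    (hS : Convex ℝ S) (hmap : ∀ x ∈ S, M.passProb x ∈ T) :
    ConcaveOn ℝ S fun η => f (M.passProb η) := by
  refine ⟨hS, fun x hx y hy a b ha hb hab => ?_⟩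
  simp only [M.passProb_combo hab]
  exact hf.2 (hmap x hx) (hmap y hy) ha hb hab

namespace Regular

variable {M : PAModel}

/-- A threshold contract with a high passing probability implements `ηstar` once the spread `Δ` of
the agent's utility satisfies the first-order condition and exceeds the cost of effort. -/
lemma threshold_incentive (h : M.Regular) {n j : ℕ} (hj : 1 ≤ j) (hjn : j < n)
    {ηstar η₁ Δ θ : ℝ} (hs : ηstar ∈ Ioo (0 : ℝ) 1) (h₁ : 0 ≤ η₁)
    (h₁j : M.passProb η₁ < j / n) (hjs : (j / n : ℝ) ≤ M.passProb ηstar) (hΔ : 0 < Δ)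
    (hfoc : Δ * ((n + 1) * binomProb n j (M.passProb ηstar) * (M.c / 2)) = deriv M.E ηstar)
    (hθ : θ ≤ 1 / 4) (hQη₁ : exceedProb n j (M.passProb η₁) ≤ θ)
    (hQηs : 1 - θ ≤ exceedProb n j (M.passProb ηstar))
    (hfar : M.E ηstar - M.E 0 ≤ Δ * (1 - 2 * θ))
    (hnear : 4 * (deriv M.E ηstar * (ηstar - η₁)) ≤ Δ) :
    ∀ η ∈ Icc (0 : ℝ) 1, Δ * exceedProb n j (M.passProb η) - M.E η
      ≤ Δ * exceedProb n j (M.passProb ηstar) - M.E ηstar := by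
  have hc := h.c_pos
  have hmono : ∀ x y, x ≤ y → M.passProb x ≤ M.passProb y := fun x y hxy => by
    unfold passProb
    nlinarith
  -- The effort at which `passProb` equals the inflection point j / n.
  set η₀ := (2 * (j / n : ℝ) - 1) / M.c with hη₀
  have hp₀ : M.passProb η₀ = j / n := by
    rw [passProb, hη₀]
    field_simp
    ring
  have h10 : η₁ < η₀ := by
    by_contra hcon
    linarith [hmono _ _ (not_lt.1 hcon)]
  have h0s : η₀ ≤ ηstar := by
    rw [hη₀, div_le_iff₀ hc]
    unfold passProb at hjs
    linarith
  refine isMaxOn_of_sigmoid (Q := fun η => exceedProb n j (M.passProb η)) h₁ h10 h0s hs.2.le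
    (M.convexOn_comp_passProb (convexOn_exceedProb hj hjn) (convex_Icc _ _) fun x hx => ?_)
    (M.concaveOn_comp_passProb (concaveOn_exceedProb hj hjn) (convex_Icc _ _) fun x hx => ?_)
    (fun x hx y hy hxy => monotoneOn_exceedProb n j ?_ ?_ (hmono x y hxy))
    ((hasDerivAt_exceedProb n j _).comp ηstar (M.hasDerivAt_passProb ηstar))
    h.convexOn_E h.strictMonoOn_E.monotoneOn (h.hasDerivAt_E hs) hΔ hfoc hθ hQη₁ hQηs hfar hnear
  · have hx' : x ∈ Icc (0 : ℝ) 1 := ⟨hx.1, by linarith [hx.2, hs.2]⟩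
    exact ⟨h.passProb_nonneg hx', hp₀ ▸ hmono _ _ hx.2⟩
  · have hx' : x ∈ Icc (0 : ℝ) 1 := ⟨by linarith [hx.1], hx.2⟩
    exact ⟨hp₀ ▸ hmono _ _ hx.1, h.passProb_le_one hx'⟩
  · exact ⟨h.passProb_nonneg hx, h.passProb_le_one hx⟩
  · exact ⟨h.passProb_nonneg hy, h.passProb_le_one hy⟩

/-! ### Near-optimal threshold contracts -/

/-- An incentive-compatible test can be turned into a contract whose loss is proportional to the
probability of failing it. -/
lemma exists_contract_of_incentive (h : M.Regular) {l : ℝ} (hl : 0 < l)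
    (hG : ∀ x ∈ Icc M.wLow M.wHigh, ∀ y ∈ Icc M.wLow M.wHigh, x ≤ y →
      l * (y - x) ≤ M.G y - M.G x)
    {n : ℕ} {Ψ : Outcome n → Bool} {η Δ : ℝ} (hη : η ∈ Icc (0 : ℝ) 1) (hΔ : 0 ≤ Δ)
    (hlow : Δ ≤ M.E η + M.U₀ - M.G M.wLow)
    (hhigh : Δ * (1 - M.passTest Ψ η) ≤ M.G M.wHigh - (M.E η + M.U₀))
    (hic : ∀ η' ∈ Icc (0 : ℝ) 1,
      Δ * M.passTest Ψ η' - M.E η' ≤ Δ * M.passTest Ψ η - M.E η) :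
    ∃ v ∈ M.restrictedValues η (M.binaryContracts n),
      M.effortValue η - Δ * (1 - M.passTest Ψ η) / l ≤ v := by
  have hp0 := M.passTest_nonneg (h.passProb_nonneg hη) (h.passProb_le_one hη) Ψ
  have hp1 := M.passTest_nonneg (h.passProb_nonneg hη) (h.passProb_le_one hη) fun a => !Ψ a
  rw [passTest_not] at hp1
  have hΔp0 := mul_nonneg hΔ hp0
  have hΔp1 := mul_nonneg hΔ hp1
  obtain ⟨hu1, hu2⟩ := h.utility_mem hη
  -- The two utility levels have spread Δ and mean E η + U₀, so individual rationality binds.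
  obtain ⟨w₁, hw₁, hGw₁⟩ := h.exists_wage (y := M.E η + M.U₀ - Δ * M.passTest Ψ η)
    ⟨by linarith, by linarith⟩
  obtain ⟨w₂, hw₂, hGw₂⟩ := h.exists_wage (y := M.E η + M.U₀ + Δ * (1 - M.passTest Ψ η))
    ⟨by linarith, by linarith⟩
  have hw : w₁ ≤ w₂ := h.strictMono_G.le_iff_le.1 (by linarith)
  have hd : M.G w₂ - M.G w₁ = Δ := by rw [hGw₁, hGw₂]; ring
  refine ⟨_, ⟨_, M.mem_binaryContracts_iff.2 ⟨Ψ, w₁, w₂, hw₁, hw₂, hw, rfl⟩, ?_, ⟨hη, ?_⟩, rfl⟩, ?_⟩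
  · rw [IsIR, agentValue_ite, hd, hGw₁]
    linarith
  · intro η' hη'
    rw [agentValue_ite, agentValue_ite, hd]
    linarith [hic η' hη']
  · rw [principalValue_ite, effortValue]
    obtain ⟨hrm, hr⟩ := h.reservationWage_spec hη
    -- The expected wage is bounded crudely by `w₂`, which is itself close to the reservation wage
    -- when the test rarely fails.
    have h1 := hG _ hrm _ hw₂ (h.strictMono_G.le_iff_le.1 (by linarith))
    have h2 : w₂ - M.reservationWage η ≤ Δ * (1 - M.passTest Ψ η) / l := by
      rw [le_div_iff₀ hl]
      linarith
    have h3 : (w₂ - w₁) * M.passTest Ψ η ≤ w₂ - w₁ :=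
      mul_le_of_le_one_right (by linarith) (by linarith)
    linarith

set_option maxHeartbeats 400000 in
/-- For many samples, the effort `ηstar` is implemented by a threshold contract with a loss of the
order `1 / √(n log n)`. -/
lemma exists_restrictedValues_ge (h : M.Regular) {ηstar : ℝ} (hs : ηstar ∈ Ioo (0 : ℝ) 1) :
    ∃ C > 0, ∀ᶠ n : ℕ in atTop, ∃ v ∈ M.restrictedValues ηstar (M.binaryContracts n),
      M.effortValue ηstar - C / Real.sqrt (n * Real.log n) ≤ v := by
  have hc := h.c_pos
  have hsm : ηstar ∈ Icc (0 : ℝ) 1 := Ioo_subset_Icc_self hs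
  have hp0 : 0 < M.passProb ηstar := by linarith [(h.passProb_mem hsm).1]
  have hp1 : M.passProb ηstar < 1 := by
    unfold passProb
    nlinarith [h.c_le, hs.1, hs.2]
  obtain ⟨l, L, hl, -, hG⟩ := h.exists_deriv_G_bounds
  have h0m : (0 : ℝ) ∈ Icc (0 : ℝ) 1 := by simp
  set e := deriv M.E ηstar with he
  have he0 : 0 < e := h.deriv_E_pos _ hs
  set D := M.E ηstar - M.E 0 with hD
  have hD0 : 0 < D := sub_pos.2 (h.strictMonoOn_E h0m hsm hs.1)
  set δ := M.E 0 + M.U₀ - M.G M.wLow with hδ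
  have hδ0 : 0 < δ := sub_pos.2 (h.utility_mem h0m).1
  set g := M.G M.wHigh - (M.E ηstar + M.U₀) with hg
  have hg0 : 0 < g := sub_pos.2 (h.utility_mem hsm).2
  -- The window for the scaled binomial probability puts the spread Δ solving the first-order
  -- condition between D + δ / 2 and D + δ: above the cost of effort, within the room over the lower
  -- wage bound.
  set τ₁ := 2 * e / (M.c * (D + δ)) with hτ₁
  set τ₂ := 2 * e / (M.c * (D + δ / 2)) with hτ₂
  have hτ₁0 : 0 < τ₁ := by positivity
  have hτ₂0 : 0 < τ₂ := by positivity
  have hτ : τ₁ < τ₂ := by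
    rw [hτ₁, hτ₂]
    gcongr
    linarith
  -- With this θ, 2 θ Δ ≤ δ / 2, hence Δ (1 - 2 θ) ≥ D.
  set θ := δ / (4 * (D + δ)) with hθ
  have hθ0 : 0 < θ := by positivity
  have hθ1 : θ ≤ 1 / 4 := by
    rw [hθ, div_le_div_iff₀ (by positivity) (by norm_num)]
    linarith
  have hθδ : θ * (D + δ) = δ / 4 := by
    rw [hθ]
    field_simp
  -- The second entry keeps the higher wage below its upper bound.
  set θ' := min θ (g / (D + δ)) with hθ'
  have hθ'0 : 0 < θ' := lt_min hθ0 (by positivity)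
  set ρ := min (ηstar / 2) (D / (4 * e)) with hρ
  have hρ0 : 0 < ρ := lt_min (by linarith [hs.1]) (by positivity)
  have hρe : 4 * (e * ρ) ≤ D := by
    have : ρ ≤ D / (4 * e) := min_le_right _ _
    rw [le_div_iff₀ (by positivity)] at this
    linarith
  have hη₁ : 0 ≤ ηstar - ρ := by
    have : ρ ≤ ηstar / 2 := min_le_left _ _
    linarith [hs.1]
  -- Lowering the effort by ρ shifts the pass probability by 2 ε. A threshold at most ε (n + 1)
  -- below the mean at `ηstar` is then at least ε (n + 1) above the mean at `ηstar - ρ`.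
  set ε := M.c * ρ / 4 with hε
  have hε0 : 0 < ε := by positivity
  have hpη₁ : M.passProb (ηstar - ρ) = M.passProb ηstar - 2 * ε := by
    unfold passProb
    rw [hε]
    ring
  obtain ⟨κ, hκ, hthr⟩ := exists_threshold hp0 hp1 hτ₁0 hτ hε0
  refine ⟨(D + δ) * (2 * τ₂ / κ) / l, by positivity, ?_⟩
  -- The number of samples is written as n + 1 to match `exceedProb`.
  rw [← map_add_atTop_eq_nat 1, eventually_map]
  have ht : Tendsto (fun n : ℕ => (n : ℝ) + 1) atTop atTop :=
    tendsto_atTop_add_const_right _ _ tendsto_natCast_atTop_atTop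
  have hr : Tendsto (fun n : ℕ => Real.sqrt (((n : ℝ) + 1) * Real.log (n + 1))) atTop atTop :=
    Real.tendsto_sqrt_atTop.comp (ht.atTop_mul_atTop₀ (Real.tendsto_log_atTop.comp ht))
  filter_upwards [hthr, ht.eventually_ge_atTop (1 / (4 * ε ^ 2 * θ)),
    hr.eventually_ge_atTop (1 / κ), hr.eventually_ge_atTop (2 * τ₂ / κ / θ')] with
    n ⟨j, hj, hjn, hb1, hb2, hmε, hmκ⟩ hn hr1 hr2
  have hn0 : (0 : ℝ) < n := by exact_mod_cast (by omega : 0 < n)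
  push_cast
  set r := Real.sqrt (((n : ℝ) + 1) * Real.log (n + 1)) with hrdef
  have hr0 : 0 < r := lt_of_lt_of_le (by positivity) hr1
  set p := M.passProb ηstar with hp
  have hm1 : 1 ≤ (n + 1) * p - j := by
    rw [div_le_iff₀ hκ] at hr1
    linarith
  have htail : 1 - exceedProb n j p ≤ 2 * τ₂ / κ / r := by
    have h1 := sum_binomProb_lower_le hp0 hp1 (by linarith) hb2
    have h2 : 2 * τ₂ / ((n + 1) * p - j) ≤ 2 * τ₂ / κ / r := by
      rw [div_div]
      gcongr
    rw [exceedProb]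
    linarith
  have htail' : 1 - exceedProb n j p ≤ θ' := by
    refine htail.trans ?_
    rw [div_le_iff₀ hθ'0] at hr2
    rw [div_le_iff₀ hr0]
    linarith
  set q := (n + 1) * binomProb n j p * (M.c / 2) with hq
  have hq0 : 0 < q := mul_pos (by linarith) (by positivity)
  set Δ := e / q with hΔ
  have hΔ0 : 0 < Δ := by positivity
  have hΔq : Δ * q = e := by rw [hΔ]; field_simp
  have hΔ1 : Δ ≤ D + δ := by
    rw [hΔ, div_le_iff₀ hq0]
    rw [hτ₁, div_le_iff₀ (by positivity)] at hb1
    rw [hq]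
    linarith
  have hΔ2 : D + δ / 2 ≤ Δ := by
    rw [hΔ, le_div_iff₀ hq0]
    rw [hτ₂, le_div_iff₀ (by positivity)] at hb2
    rw [hq]
    linarith
  have hQ1 : exceedProb n j (M.passProb (ηstar - ρ)) ≤ θ := by
    have hm : ηstar - ρ ∈ Icc (0 : ℝ) 1 := ⟨hη₁, by linarith [hs.2]⟩
    refine (exceedProb_le_of_far hjn.le (h.passProb_nonneg hm) (h.passProb_le_one hm)
      (R := ε * (n + 1)) (by positivity) ?_).trans ?_
    · rw [hpη₁]
      linarith
    · rw [div_le_iff₀ (by positivity)] at hn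
      rw [div_le_iff₀ (by positivity)]
      calc (n : ℝ) + 1 ≤ (n + 1) * ((n + 1) * (4 * ε ^ 2 * θ)) :=
            le_mul_of_one_le_right (by positivity) hn
        _ = _ := by ring
  have hθΔ : θ * Δ ≤ δ / 4 := by
    rw [← hθδ]
    gcongr
  have hexc : 0 ≤ 1 - exceedProb n j p := sub_nonneg.2 (exceedProb_le_one hp0.le hp1.le _ _)
  have hic := h.threshold_incentive hj hjn hs hη₁ (Δ := Δ) (θ := θ)
    (by
      have : ε * 1 ≤ ε * n := by gcongr; exact_mod_cast (by omega : 1 ≤ n)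
      rw [hpη₁, lt_div_iff₀ hn0]
      linarith)
    (by
      rw [div_le_iff₀ hn0]
      linarith)
    hΔ0 hΔq hθ1 hQ1 (by linarith [htail'.trans (min_le_left _ _)]) (by linarith)
    (by
      rw [sub_sub_cancel]
      linarith)
  simp only [← M.passTest_thresholdTest hjn.le] at hic
  have hexp : M.passTest (thresholdTest (n + 1) j) ηstar = exceedProb n j p :=
    M.passTest_thresholdTest hjn.le ηstar
  have hgΔ : Δ * (1 - exceedProb n j p) ≤ g := by
    have h1 := htail'.trans (min_le_right _ _)
    calc _ ≤ (D + δ) * (g / (D + δ)) := by gcongr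
      _ = g := by field_simp
  obtain ⟨v, hv, hv'⟩ := h.exists_contract_of_incentive hl
    (fun x hx y hy hxy => (hG x hx y hy hxy).1) hsm hΔ0.le (by linarith)
    (by rw [hexp]; exact hgΔ) hic
  refine ⟨v, hv, le_trans ?_ hv'⟩
  rw [hexp]
  have hfin : Δ * (1 - exceedProb n j p) / l ≤ (D + δ) * (2 * τ₂ / κ) / l / r := by
    calc _ ≤ (D + δ) * (2 * τ₂ / κ / r) / l := by gcongr
      _ = _ := by ring
  linarith

end Regular

/-! ### The order of the gaps -/

/-- A function between `a / r` and `b / r` is of exact order `1 / r`. -/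
lemma isTheta_one_div {f r : ℕ → ℝ} {a b : ℝ} (ha : 0 < a) (hr : ∀ n, 0 ≤ r n)
    (hlow : ∀ᶠ n in atTop, a / r n ≤ f n) (hup : ∀ᶠ n in atTop, f n ≤ b / r n) :
    f =Θ[atTop] fun n => 1 / r n := by
  constructor
  · refine IsBigO.of_bound b ?_
    filter_upwards [hlow, hup] with n h1 h2
    rw [Real.norm_of_nonneg ((div_nonneg ha.le (hr n)).trans h1),
      Real.norm_of_nonneg (one_div_nonneg.2 (hr n)), mul_one_div]
    exact h2
  · refine IsBigO.of_bound a⁻¹ ?_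
    filter_upwards [hlow] with n h1
    rw [Real.norm_of_nonneg ((div_nonneg ha.le (hr n)).trans h1),
      Real.norm_of_nonneg (one_div_nonneg.2 (hr n)), inv_mul_eq_div, le_div_iff₀ ha,
      one_div_mul_eq_div]
    exact h1

end PAModel

end

theorem theorem1 (M : PAModel) (ηstar : ℝ)
    -- informative samples, with pass probabilities `(1 + c η) / 2`
    (hc : M.c ∈ Ioc (0 : ℝ) 1)
    -- the agent's monetary utility and effort cost
    (hG : ContDiff ℝ 2 M.G)
    (hG₁ : ∀ w, 0 < deriv M.G w)
    (hG₂ : ∀ w, deriv (deriv M.G) w < 0)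
    (hE : ContDiffOn ℝ 2 M.E (Icc 0 1))
    (hE₁ : ∀ η ∈ Ioo (0 : ℝ) 1, 0 < deriv M.E η)
    (hE₂ : ∀ η ∈ Ioo (0 : ℝ) 1, 0 ≤ deriv (deriv M.E) η)
    -- the principal's utility of the effort
    (hμ : ContDiffOn ℝ 2 M.μ (Icc 0 1))
    (hμ₁ : ∀ η ∈ Ioo (0 : ℝ) 1, 0 ≤ deriv M.μ η)
    (hμ₂ : ∀ η ∈ Ioo (0 : ℝ) 1, deriv (deriv M.μ) η ≤ 0)
    -- the wage range covers all efforts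
    (hw : (fun η => M.E η + M.U₀) '' Icc 0 1 ⊆ interior (M.G '' Icc M.wLow M.wHigh))
    -- the first-best effort is interior
    (hstar : M.IsFirstBestEffort ηstar) (hstar' : ηstar ∈ Ioo (0 : ℝ) 1)
    -- the contracts allowed in the first-best program
    (𝓕 : (n : ℕ) → Set (Contract n))
    (h𝓕 : ∀ n, M.binaryContracts n ⊆ 𝓕 n) (h𝓕' : ∀ n, 𝓕 n ⊆ M.boundedContracts n) :
    -- the three maxima exist
    (∀ n, IsGreatest (M.firstBestValues (𝓕 n)) (M.firstBest (𝓕 n))) ∧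
    (∀ n, IsGreatest (M.secondBestValues (M.binaryContracts n))
      (M.secondBest (M.binaryContracts n))) ∧
    (∀ᶠ n : ℕ in atTop, IsGreatest (M.restrictedValues ηstar (M.binaryContracts n))
      (M.restrictedSecondBest ηstar (M.binaryContracts n))) ∧
    -- the gaps
    ((fun n : ℕ => M.firstBest (𝓕 n) - M.restrictedSecondBest ηstar (M.binaryContracts n))
      =Θ[atTop] fun n : ℕ => 1 / Real.sqrt (n * Real.log n)) ∧
    ((fun n : ℕ => M.firstBest (𝓕 n) - M.secondBest (M.binaryContracts n))
      =Θ[atTop] fun n : ℕ => 1 / Real.sqrt (n * Real.log n)) := by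
  have h : M.Regular := ⟨hc.1, hc.2, hG, hG₁, hG₂, hE, hE₁, hE₂, hμ, hμ₂, hw⟩
  have hFB : ∀ n, M.firstBest (𝓕 n) = M.effortValue ηstar := fun n => h.firstBest_eq hstar (h𝓕 n)
  obtain ⟨κ, hκ, hlow⟩ := h.exists_secondBest_le hstar hstar'
  obtain ⟨C, -, hup⟩ := h.exists_restrictedValues_ge hstar'
  have hres : ∀ᶠ n : ℕ in atTop, IsGreatest (M.restrictedValues ηstar (M.binaryContracts n))
      (M.restrictedSecondBest ηstar (M.binaryContracts n)) := by
    filter_upwards [hup] with n ⟨v, hv, _⟩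
    exact h.isGreatest_restricted ⟨v, hv⟩
  -- The restricted value is the smaller one, so the upper bound on the second best and the lower
  -- bound on the restricted value control both gaps.
  have hle : ∀ᶠ n : ℕ in atTop, M.restrictedSecondBest ηstar (M.binaryContracts n)
      ≤ M.secondBest (M.binaryContracts n) := by
    filter_upwards [hres] with n hn
    obtain ⟨F, hF, hir, hic, hv⟩ := hn.1
    exact (h.isGreatest_secondBest n).2 ⟨F, hF, ηstar, hir, hic, hv⟩
  have hge : ∀ᶠ n : ℕ in atTop, M.effortValue ηstar - C / Real.sqrt (n * Real.log n)
      ≤ M.restrictedSecondBest ηstar (M.binaryContracts n) := by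
    filter_upwards [hup, hres] with n ⟨v, hv, hv'⟩ hn
    exact hv'.trans (hn.2 hv)
  refine ⟨fun n => ?_, h.isGreatest_secondBest, hres, ?_, ?_⟩
  · rw [hFB]
    exact h.isGreatest_firstBestValues hstar (h𝓕 n)
  · refine PAModel.isTheta_one_div (b := C) hκ (fun n => Real.sqrt_nonneg _) ?_ ?_
    · filter_upwards [hlow, hle] with n h1 h2
      rw [hFB]
      linarith
    · filter_upwards [hge] with n h1
      rw [hFB]
      linarith
  · refine PAModel.isTheta_one_div (b := C) hκ (fun n => Real.sqrt_nonneg _) ?_ ?_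
    · filter_upwards [hlow] with n h1
      rw [hFB]
      linarith
    · filter_upwards [hge, hle] with n h1 h2
      rw [hFB]
      linarith
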